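/- Let $\Sigma$ be a finite alphabet. A \emph{case problem} $Q[S]$ consists of a language of pairs $Q \subseteq \Sigma^*\times\Sigma^*$ and a set $S \subseteq \Sigma^*$. A partial mapping $r : \Sigma^*\times\Sigma^*\times\Sigma^* \to \Sigma^*$ is \emph{FPT-computable with respect to the parameterization} $(\pi_1,\pi_2)$ if there exist a partial computable function $f : \Sigma^*\times\Sigma^* \to \mathbb{N}$, a polynomial $p : \mathbb{N}\to\mathbb{N}$ and a (multi-stack) Turing machine $A$ such that for every $x=(t,t',y) \in \mathrm{dom}(r)$, the value $f(t,t')$ is defined and $A$, on input $x$, outputs $r(x)$ after at most $f(t,t')\cdot p(|x|)$ steps. Here $x$ is presented to $A$ as the string $t\,\#\,t'\,\#\,y$ with a separator $\# \notin \Sigma$, and $|x|$ is the length of this string. No condition is imposed on inputs outside $\mathrm{dom}(r)$. A case problem $Q[S]$ \emph{slice reduces} to a case problem $Q'[S']$ if there exist a computably enumerable language $U \subseteq \Sigma^*\times\Sigma^*$ and a partial mapping $r : \Sigma^*\times\Sigma^*\times\Sigma^* \to \Sigma^*$ with $\mathrm{dom}(r) = U\times\Sigma^*$ that is FPT-computable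 with respect to $(\pi_1,\pi_2)$, such that \begin{itemize} \item (coverage) for each $s \in S$ there exists $s' \in S'$ with $(s,s') \in U$, and \item (correctness) for each $(t,t') \in U$ and each $y \in \Sigma^*$, $(t,y) \in Q \Leftrightarrow (t', r(t,t',y)) \in Q'$. \end{itemize} \textbf{Theorem} (transitivity of slice reducibility). If $Q_1[S_1]$ slice reduces to $Q_2[S_2]$ and $Q_2[S_2]$ slice reduces to $Q_3[S_3]$, then $Q_1[S_1]$ slice reduces to $Q_3[S_3]$. -/

import Mathlib

/-- Let `r` be a partial mapping on a set `α` of inputs with string values over the alphabet `Γ`,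
where inputs are presented to machines as strings over an alphabet `A` through `enc`, and let
`κ : α → P` be a parameterization. The mapping `r` is FPT-computable with respect to `κ` if there
are a computable function `f` of the parameter, a polynomial `p` and one (multi-stack) Turing
machine `M` which, on each input `x` in the domain of `r`, halts with output `r x` after at most
`f (κ x) * p |x|` steps. This is a promise notion: nothing is required on inputs outside the domain
of `r`; correspondingly, `f` has to be defined on the parameters of inputs in the domain of `r`
only, i.e. it is a partial computable function. -/
def FPTComputable {α P A Γ : Type} [Primcodable P] (enc : α → List A) (κ : α → P)
    (r : α →. List Γ) : Prop :=
  ∃ (f : P →. ℕ) (p : Polynomial ℕ) (M : Turing.TM2ComputableAux A Γ),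
    Partrec f ∧
    ∀ x : α, ∀ z ∈ r x, ∃ n ∈ f (κ x),
      Nonempty (Turing.TM2OutputsInTime M.tm ((enc x).map M.inputAlphabet.symm)
        (some (z.map M.outputAlphabet.symm)) (n * p.eval (enc x).length))

/-- Encoding of a triple of strings over `Γ` as the single string `s # t # y`, where the
additional letter `#` is `none`. -/
def encodeTriple {Γ : Type} (x : List Γ × List Γ × List Γ) : List (Option Γ) :=
  x.1.map some ++ none :: (x.2.1.map some ++ none :: x.2.2.map some)

/-- A case problem `Q[S]` over the alphabet `Γ`: a language of pairs `Q` together with a set of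
strings `S`. -/
structure CaseProblem (Γ : Type) where
  /-- the language of pairs `Q` -/
  Q : Set (List Γ × List Γ)
  /-- the set `S` of admitted first components -/
  S : Set (List Γ)

/-- The pair `(U, r)` is a slice reduction from the case problem `C` to the case problem `D`. -/
structure IsSliceReduction {Γ : Type} [Primcodable Γ] (C D : CaseProblem Γ)
    (U : Set (List Γ × List Γ)) (r : List Γ × List Γ × List Γ →. List Γ) : Prop where
  /-- `U` is computably enumerable -/
  re : REPred fun u : List Γ × List Γ => u ∈ U
  /-- the domain of `r` is `U × Γ*` -/
  dom : ∀ t t' y : List Γ, (r (t, t', y)).Dom ↔ (t, t') ∈ U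
  /-- `r` is FPT-computable with respect to the parameterization `(π₁, π₂)` -/
  fpt : FPTComputable encodeTriple (fun x : List Γ × List Γ × List Γ => (x.1, x.2.1)) r
  coverage : ∀ s ∈ C.S, ∃ s' ∈ D.S, (s, s') ∈ U
  correctness : ∀ t t' : List Γ, (t, t') ∈ U → ∀ y : List Γ, ∀ z ∈ r (t, t', y),
    ((t, y) ∈ C.Q ↔ (t', z) ∈ D.Q)

/-- The case problem `C` slice reduces to the case problem `D`. -/
def CaseProblem.SliceReducesTo {Γ : Type} [Primcodable Γ] (C D : CaseProblem Γ) : Prop :=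
  ∃ (U : Set (List Γ × List Γ)) (r : List Γ × List Γ × List Γ →. List Γ), IsSliceReduction C D U r

/-! The relation `U` cannot simply be the composite of the two given relations: a pair `(t, t'')`
may have many intermediate parameters `t'`, and a machine has to settle on one. The triples with
`(t, t') ∈ U₁` and `(t', t'') ∈ U₂` form a computably enumerable relation, so dovetailing gives a
partial computable `g` that picks such a `t'` exactly when one exists (`REPred.exists_selector`).
Then `U` is the domain of `g`, and the reduction sends `(t, t'', y)` to `r₂ (t', t'', r₁ (t, t',
y))` with `t' = g (t, t'')`. Coverage and correctness follow at once.

The work lies in the running time (`FPTComputable.comp_selector`). Since `t'` depends on `(t, t'')`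
alone, its length, the values of `f₁` and `f₂`, and the time spent on computing it may all enter the
parameter factor. That factor must itself be partial computable, hence the number of steps of the
machine for `g` is obtained by simulating it (`exists_partrec_steps`). The output of the first
machine exceeds its input by at most a constant times its running time (`exists_length_output_le`),
so the second machine also stays within an FPT bound (`composition_bound`).

The composed machine is built explicitly: programs are embedded on disjoint stacks (`Module.embed`),
chained (`Module.seq`), and linked by loops that move words between stacks (`transfer`). -/

open Function

/-! ### Exact step counts and stack growth. -/

namespace Turing.TM2

/-- `Steps m n c c'` says that the machine `m` gets from `c` to `c'` in exactly `n` steps. -/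
def Steps {K : Type} [DecidableEq K] {Γ : K → Type} {Λ σ : Type} (m : Λ → Stmt Γ Λ σ) :
    ℕ → Cfg Γ Λ σ → Cfg Γ Λ σ → Prop
  | 0, c, c' => c = c'
  | n + 1, c, c' => ∃ d, step m c = some d ∧ Steps m n d c'

section Steps

variable {K : Type} [DecidableEq K] {Γ : K → Type} {Λ σ : Type} {m : Λ → Stmt Γ Λ σ}

theorem Steps.trans {n n' : ℕ} {a b c : Cfg Γ Λ σ} (h : Steps m n a b) (h' : Steps m n' b c) :
    Steps m (n + n') a c := by
  induction n generalizing a with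
  | zero => cases h; simpa using h'
  | succ n ih =>
    obtain ⟨d, hd, h⟩ := h
    rw [Nat.add_right_comm]
    exact ⟨d, hd, ih h⟩

/-- Links the relation to the iterated form that underlies `TM2OutputsInTime`; once `none` is
reached, it persists. -/
theorem steps_iff_iterate {n : ℕ} {a b : Cfg Γ Λ σ} :
    Steps m n a b ↔ (flip bind (step m))^[n] (some a) = some b := by
  have hnone : ∀ n : ℕ, (flip bind (step m))^[n] none = none := fun n =>
    Function.iterate_fixed rfl n
  induction n generalizing a with
  | zero => simp [Steps]
  | succ n ih =>
    rw [Function.iterate_succ_apply]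
    change (∃ d, step m a = some d ∧ Steps m n d b) ↔ (flip bind (step m))^[n] (step m a) = some b
    cases h : step m a with
    | none => simp only [hnone, reduceCtorEq, false_and, exists_false]
    | some d => simp [ih]

theorem exists_steps_of_reaches {a b : Cfg Γ Λ σ} (h : StateTransition.Reaches (step m) a b) :
    ∃ n, Steps m n a b := by
  induction h using Relation.ReflTransGen.head_induction_on with
  | refl => exact ⟨0, rfl⟩
  | head h _ ih => obtain ⟨n, hn⟩ := ih; exact ⟨n + 1, _, h, hn⟩

/-- The number of pushes in a statement. -/
def Stmt.pushes : Stmt Γ Λ σ → ℕ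
  | .push _ _ q => q.pushes + 1
  | .peek _ _ q => q.pushes
  | .pop _ _ q => q.pushes
  | .load _ q => q.pushes
  | .branch _ q₁ q₂ => q₁.pushes + q₂.pushes
  | .goto _ => 0
  | .halt => 0

theorem length_stepAux_le (q : Stmt Γ Λ σ) (v : σ) (S : ∀ k, List (Γ k)) (k : K) :
    ((stepAux q v S).stk k).length ≤ (S k).length + q.pushes := by
  induction q generalizing v S with
  | push k' f q ih =>
    refine (ih _ _).trans ?_
    by_cases h : k = k'
    · subst h; simp only [update_self, List.length_cons, Stmt.pushes]; omega
    · simp only [update_of_ne h, Stmt.pushes]; omega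
  | peek k' f q ih => exact ih _ _
  | pop k' f q ih =>
    refine (ih _ _).trans ?_
    by_cases h : k = k'
    · subst h; simp [Stmt.pushes]
    · simp [Stmt.pushes, h]
  | load f q ih => exact ih _ _
  | branch f q₁ q₂ ih₁ ih₂ =>
    simp only [stepAux, Stmt.pushes]
    cases f v
    · exact (ih₂ _ _).trans (by omega)
    · exact (ih₁ _ _).trans (by omega)
  | goto f => simp [Stmt.pushes]
  | halt => simp [Stmt.pushes]

/-- A step executes one whole statement, so its pushes bound the growth of a stack per step. This
later controls the output of the first reduction. -/
theorem Steps.length_le {c n : ℕ} {a b : Cfg Γ Λ σ} (hc : ∀ l, (m l).pushes ≤ c)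
    (h : Steps m n a b) (k : K) : (b.stk k).length ≤ (a.stk k).length + c * n := by
  induction n generalizing a with
  | zero => cases h; simp
  | succ n ih =>
    obtain ⟨d, hd, h⟩ := h
    refine (ih h).trans ?_
    obtain ⟨l, v, S⟩ := a
    cases l with
    | none => simp at hd
    | some l =>
      simp only [step, Option.some.injEq] at hd
      subst hd
      have := length_stepAux_le (m l) v S k
      have := hc l
      simp only [Nat.mul_succ]
      omega

end Steps

/-! ### Simulation inside a larger machine. -/

section Lift

variable {K K' : Type} [DecidableEq K] [DecidableEq K'] {Γ : K' → Type} {Λ Λ' σ σ' : Type}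

/-- Transport a statement to a machine with more stacks, a larger internal state and more labels;
halting is replaced by a jump to `ex`. -/
def Stmt.lift (ι : K → K') (get : σ' → σ) (set : σ → σ' → σ') (ρ : Λ → Λ') (ex : Option Λ') :
    Stmt (fun k => Γ (ι k)) Λ σ → Stmt Γ Λ' σ'
  | .push k f q => .push (ι k) (fun s => f (get s)) (q.lift ι get set ρ ex)
  | .peek k f q => .peek (ι k) (fun s o => set (f (get s) o) s) (q.lift ι get set ρ ex)
  | .pop k f q => .pop (ι k) (fun s o => set (f (get s) o) s) (q.lift ι get set ρ ex)
  | .load f q => .load (fun s => set (f (get s)) s) (q.lift ι get set ρ ex)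
  | .branch f q₁ q₂ => .branch (fun s => f (get s)) (q₁.lift ι get set ρ ex)
      (q₂.lift ι get set ρ ex)
  | .goto f => .goto fun s => ρ (f (get s))
  | .halt => ex.elim .halt fun l => .goto fun _ => l

/-- A machine configuration and its transported version, where `s₀` and `T₀` give the parts of the
internal state and of the stacks that the machine does not touch. -/
structure LiftRel (ι : K → K') (set : σ → σ' → σ') (ρ : Λ → Λ') (ex : Option Λ')
    (s₀ : σ') (T₀ : ∀ k, List (Γ k)) (c : Cfg (fun k => Γ (ι k)) Λ σ) (d : Cfg Γ Λ' σ') :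
    Prop where
  label : d.l = c.l.elim ex fun l => some (ρ l)
  var : d.var = set c.var s₀
  stk : ∀ k, d.stk (ι k) = c.stk k
  stk_of_notMem : ∀ k, k ∉ Set.range ι → d.stk k = T₀ k

variable {ι : K → K'} {get : σ' → σ} {set : σ → σ' → σ'} {ρ : Λ → Λ'} {ex : Option Λ'}

theorem liftRel_stepAux (hι : Injective ι) (hgs : ∀ a s, get (set a s) = a)
    (hss : ∀ a b s, set a (set b s) = set a s) (s₀ : σ') (T₀ : ∀ k, List (Γ k))
    (q : Stmt (fun k => Γ (ι k)) Λ σ) (v : σ) (S : ∀ k, List (Γ (ι k))) (T : ∀ k, List (Γ k))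
    (hT : ∀ k, T (ι k) = S k) (hT₀ : ∀ k, k ∉ Set.range ι → T k = T₀ k) :
    LiftRel ι set ρ ex s₀ T₀ (stepAux q v S)
      (stepAux (q.lift ι get set ρ ex) (set v s₀) T) := by
  induction q generalizing v S T with
  | push k f q ih =>
    simp only [Stmt.lift, stepAux, hgs]
    refine ih _ _ _ (fun k' => ?_) fun k' hk' => ?_
    · by_cases h : k' = k
      · subst h; simp [hT]
      · simp [h, hι.ne h, hT]
    · rw [update_of_ne (by rintro rfl; exact hk' ⟨k, rfl⟩), hT₀ _ hk']
  | peek k f q ih =>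
    simp only [Stmt.lift, stepAux, hgs, hss, hT]
    exact ih _ _ _ hT hT₀
  | pop k f q ih =>
    simp only [Stmt.lift, stepAux, hgs, hss, hT]
    refine ih _ _ _ (fun k' => ?_) fun k' hk' => ?_
    · by_cases h : k' = k
      · subst h; simp
      · simp [h, hι.ne h, hT]
    · rw [update_of_ne (by rintro rfl; exact hk' ⟨k, rfl⟩), hT₀ _ hk']
  | load f q ih =>
    simp only [Stmt.lift, stepAux, hgs, hss]
    exact ih _ _ _ hT hT₀
  | branch f q₁ q₂ ih₁ ih₂ =>
    simp only [Stmt.lift, stepAux, hgs]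
    cases f v
    · exact ih₂ _ _ _ hT hT₀
    · exact ih₁ _ _ _ hT hT₀
  | goto f =>
    simp only [Stmt.lift, stepAux, hgs]
    exact ⟨rfl, rfl, hT, hT₀⟩
  | halt =>
    cases ex
    · exact ⟨rfl, rfl, hT, hT₀⟩
    · exact ⟨rfl, rfl, hT, hT₀⟩

/-- The closed set `P` of labels allows a machine with infinitely many labels to be cut down to a
finite supporting set. Steps correspond one to one. -/
theorem Steps.lift {m : Λ → Stmt (fun k => Γ (ι k)) Λ σ} {m' : Λ' → Stmt Γ Λ' σ'} {P : Set Λ}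
    (hι : Injective ι) (hgs : ∀ a s, get (set a s) = a)
    (hss : ∀ a b s, set a (set b s) = set a s) {s₀ : σ'} {T₀ : ∀ k, List (Γ k)}
    (hm : ∀ l ∈ P, m' (ρ l) = (m l).lift ι get set ρ ex)
    (hP : ∀ l ∈ P, ∀ v S, ∀ l' ∈ (stepAux (m l) v S).l, l' ∈ P)
    {n : ℕ} {c c' : Cfg (fun k => Γ (ι k)) Λ σ} {d : Cfg Γ Λ' σ'}
    (hc : ∀ l ∈ c.l, l ∈ P) (hd : LiftRel ι set ρ ex s₀ T₀ c d) (h : Steps m n c c') :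
    ∃ d', Steps m' n d d' ∧ LiftRel ι set ρ ex s₀ T₀ c' d' := by
  induction n generalizing c d with
  | zero => cases h; exact ⟨d, rfl, hd⟩
  | succ n ih =>
    obtain ⟨e, he, h⟩ := h
    obtain ⟨l, v, S⟩ := c
    obtain ⟨l', s, T⟩ := d
    cases l with
    | none => simp at he
    | some l =>
      simp only [step, Option.some.injEq] at he
      subst he
      obtain ⟨h₁, h₂, h₃, h₄⟩ := hd
      simp only [Option.elim] at h₁ h₂ h₃ h₄
      subst h₁ h₂
      have hl := hc l rfl
      have hr := liftRel_stepAux (ex := ex) (ρ := ρ) hι hgs hss s₀ T₀ (m l) v S T h₃ h₄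
      rw [← hm l hl] at hr
      obtain ⟨d', hd', hr'⟩ := ih (hP l hl v S) hr h
      exact ⟨d', ⟨_, rfl, hd'⟩, hr'⟩

end Lift

/-! ### Programs and their combination. -/

/-- A machine program with finitely many labels and a distinguished first label. Halting is
understood as leaving the program. -/
structure Module {K : Type} (Γ : K → Type) (σ : Type) where
  Λ : Type
  [fintype : Fintype Λ]
  main : Λ
  m : Λ → Stmt Γ Λ σ

namespace Module

variable {K : Type} [DecidableEq K] {Γ : K → Type} {σ : Type}

/-- The program `M`, started and left with internal state `s`, turns the stacks `T` into `T'` in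
`n` steps. -/
def Runs (M : Module Γ σ) (s : σ) (n : ℕ) (T T' : ∀ k, List (Γ k)) : Prop :=
  Steps M.m n ⟨some M.main, s, T⟩ ⟨none, s, T'⟩

theorem Runs.of_eq {M : Module Γ σ} {s : σ} {n n' : ℕ} {T T' : ∀ k, List (Γ k)}
    (h : M.Runs s n T T') (hn : n = n') : M.Runs s n' T T' :=
  hn ▸ h

/-- Sequential composition. -/
def seq (M N : Module Γ σ) : Module Γ σ :=
  haveI := M.fintype
  haveI := N.fintype
  { Λ := M.Λ ⊕ N.Λ
    main := .inl M.main
    m := Sum.elim (fun l => (M.m l).lift id id (fun a _ => a) Sum.inl (some (.inr N.main)))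
      fun l => (N.m l).lift id id (fun a _ => a) Sum.inr none }

/-- The jump to `N` replaces the halt of `M` within the same step, so the times add without
overhead. -/
theorem Runs.seq {M N : Module Γ σ} {s : σ} {n n' : ℕ} {T T' T'' : ∀ k, List (Γ k)}
    (h : M.Runs s n T T') (h' : N.Runs s n' T' T'') : (M.seq N).Runs s (n + n') T T'' := by
  have h₁ := Steps.lift (ι := id) (get := id) (set := fun a _ => a) (ρ := Sum.inl)
    (ex := some (Sum.inr N.main)) (m' := (M.seq N).m) (P := Set.univ) injective_id
    (fun _ _ => rfl) (fun _ _ _ => rfl) (s₀ := s) (T₀ := T) (fun _ _ => rfl)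
    (fun _ _ _ _ _ _ => trivial) (fun _ _ => trivial) (d := ⟨some (.inl M.main), s, T⟩)
    ⟨rfl, rfl, fun _ => rfl, fun _ _ => rfl⟩ h
  have h₂ := Steps.lift (ι := id) (get := id) (set := fun a _ => a) (ρ := Sum.inr)
    (ex := none) (m' := (M.seq N).m) (P := Set.univ) injective_id
    (fun _ _ => rfl) (fun _ _ _ => rfl) (s₀ := s) (T₀ := T) (fun _ _ => rfl)
    (fun _ _ _ _ _ _ => trivial) (fun _ _ => trivial) (d := ⟨some (.inr N.main), s, T'⟩)
    ⟨rfl, rfl, fun _ => rfl, fun k hk => absurd ⟨k, rfl⟩ hk⟩ h'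
  obtain ⟨⟨l₁, v₁, S₁⟩, hs₁, a₁, b₁, c₁, -⟩ := h₁
  obtain ⟨⟨l₂, v₂, S₂⟩, hs₂, a₂, b₂, c₂, -⟩ := h₂
  obtain rfl : S₁ = T' := funext c₁
  obtain rfl : S₂ = T'' := funext c₂
  simp only [Option.elim] at a₁ b₁ a₂ b₂
  subst a₁ b₁ a₂ b₂
  exact hs₁.trans hs₂

/-- The program with a single label that repeats the statement `q`. -/
def loop (q : Stmt Γ Unit σ) : Module Γ σ where
  Λ := Unit
  main := ()
  m _ := q

/-- Each letter costs one step, and one more step detects the end. -/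
theorem loop_runs {α : Type*} {q : Stmt Γ Unit σ} {s : σ}
    {St : List α → List α → ∀ k, List (Γ k)} {T : List α → ∀ k, List (Γ k)}
    (h : ∀ a l acc, stepAux q s (St (a :: l) acc) = ⟨some (), s, St l (a :: acc)⟩)
    (h₀ : ∀ acc, stepAux q s (St [] acc) = ⟨none, s, T acc⟩) (l acc : List α) :
    (loop q).Runs s (l.length + 1) (St l acc) (T (l.reverse ++ acc)) := by
  induction l generalizing acc with
  | nil => exact ⟨_, congrArg some (h₀ acc), rfl⟩
  | cons a l ih =>
    refine ⟨_, congrArg some (h a l acc), ?_⟩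
    have := ih (a :: acc)
    rwa [← List.singleton_append, ← List.append_assoc, ← List.reverse_cons] at this

/-- A program with fewer stacks and a smaller internal state as a part of a larger one. -/
def embed {K' : Type} {σ' : Type} {Γ : K' → Type} (ι : K → K') (get : σ' → σ) (set : σ → σ' → σ')
    (M : Module (fun k => Γ (ι k)) σ) : Module Γ σ' :=
  haveI := M.fintype
  { Λ := M.Λ
    main := M.main
    m := fun l => (M.m l).lift ι get set id none }

theorem Runs.embed {K' : Type} [DecidableEq K'] {σ' : Type} {Γ : K' → Type} {ι : K → K'}
    {get : σ' → σ} {set : σ → σ' → σ'} {M : Module (fun k => Γ (ι k)) σ} (hι : Injective ι)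
    (hgs : ∀ a s, get (set a s) = a) (hss : ∀ a b s, set a (set b s) = set a s)
    {s : σ} {s' : σ'} (hs : set s s' = s') {n : ℕ} {T T' : ∀ k, List (Γ k)}
    (h : M.Runs s n (fun k => T (ι k)) (fun k => T' (ι k)))
    (hT : ∀ k, k ∉ Set.range ι → T' k = T k) :
    (M.embed ι get set).Runs s' n T T' := by
  have h₁ := Steps.lift (ι := ι) (get := get) (set := set) (ρ := id)
    (ex := none) (m' := (M.embed ι get set).m) (P := Set.univ) hι
    hgs hss (s₀ := s') (T₀ := T) (fun _ _ => rfl)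
    (fun _ _ _ _ _ _ => trivial) (fun _ _ => trivial) (d := ⟨some M.main, s', T⟩)
    ⟨rfl, hs.symm, fun _ => rfl, fun _ _ => rfl⟩ h
  obtain ⟨⟨l₁, v₁, S₁⟩, hs₁, a₁, b₁, c₁, d₁⟩ := h₁
  obtain rfl : S₁ = T' := by
    funext k
    by_cases hk : k ∈ Set.range ι
    · obtain ⟨k, rfl⟩ := hk
      exact c₁ k
    · exact (d₁ k hk).trans (hT k hk).symm
  simp only [Option.elim, hs] at a₁ b₁
  subst a₁ b₁
  exact hs₁

end Module

end Turing.TM2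

/-! ### Computable choice from enumerable relations. -/

section

variable {α β γ : Type} [Primcodable α] [Primcodable β] [Primcodable γ]

theorem Primrec.of_finite_left [Finite α] [Inhabited γ] {f : α → β → γ}
    (hf : ∀ a, Primrec (f a)) : Primrec₂ f := by
  classical
  cases nonempty_fintype α
  suffices h : ∀ L : List α, ∃ g : α × β → γ, Primrec g ∧ ∀ a ∈ L, ∀ b, g (a, b) = f a b by
    obtain ⟨g, hg, hfg⟩ := h Finset.univ.toList
    exact hg.of_eq fun p => hfg p.1 (by simp) p.2
  intro L
  induction L with
  | nil => exact ⟨fun _ => default, Primrec.const _, by simp⟩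
  | cons a L ih =>
    obtain ⟨g, hg, hfg⟩ := ih
    refine ⟨fun p => if p.1 = a then f a p.2 else g p,
      Primrec.ite (Primrec.eq.comp Primrec.fst (Primrec.const a)) ((hf a).comp Primrec.snd) hg, ?_⟩
    intro b hb c
    by_cases h : b = a
    · simp [h]
    · simpa [h] using hfg b (by simpa [h] using hb) c

/-- A computably enumerable relation has a partial computable choice function. -/
theorem REPred.exists_selector {W : α × β → Prop} (hW : REPred W) :
    ∃ g : α →. β, Partrec g ∧ (∀ a, (g a).Dom ↔ ∃ b, W (a, b)) ∧ ∀ a, ∀ b ∈ g a, W (a, b) := by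
  obtain ⟨c, hc⟩ := Nat.Partrec.Code.exists_code.1 hW
  have hmem : ∀ p : α × β, W p ↔ ∃ k, (c.evaln k (Encodable.encode p)).isSome := by
    intro p
    have h₁ : W p ↔ ∃ x, x ∈ c.eval (Encodable.encode p) := by
      rw [hc]
      simp [Part.mem_assert_iff]
    simp only [h₁, Nat.Partrec.Code.evaln_complete, Option.isSome_iff_exists]
    exact exists_comm
  -- Dovetailing: `n` codes a step bound together with a candidate `b`, accepted if membership is
  -- confirmed within that bound.
  let F : α → ℕ → Option β := fun a n =>
    (Encodable.decode (α := β) n.unpair.2).bind fun b =>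
      bif (c.evaln n.unpair.1 (Encodable.encode (a, b))).isSome then some b else none
  have hF : Primrec₂ F := by
    have hu : Primrec fun p : α × ℕ => p.2.unpair := Primrec.unpair.comp Primrec.snd
    refine Primrec.option_bind (Primrec.decode.comp (Primrec.snd.comp hu)) ?_
    refine Primrec.cond (Primrec.option_isSome.comp (Nat.Partrec.Code.primrec_evaln.comp
      (Primrec.pair (Primrec.pair (Primrec.fst.comp (hu.comp Primrec.fst)) (Primrec.const c)) ?_)))
      (Primrec.option_some.comp Primrec.snd) (Primrec.const none)
    exact Primrec.encode.comp (Primrec.pair (Primrec.fst.comp Primrec.fst) Primrec.snd)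
  have hFW : ∀ a n b, b ∈ F a n → W (a, b) := by
    intro a n b hb
    obtain ⟨b', -, hb'⟩ := Option.bind_eq_some_iff.1 hb
    cases h : (c.evaln n.unpair.1 (Encodable.encode (a, b'))).isSome
    · rw [h] at hb'; simp at hb'
    · rw [h, cond_true, Option.some.injEq] at hb'
      subst hb'
      exact (hmem _).2 ⟨_, h⟩
  refine ⟨fun a => Nat.rfindOpt (F a), Partrec.rfindOpt hF.to_comp, fun a => ?_, fun a b hb => ?_⟩
  · rw [Nat.rfindOpt_dom]
    constructor
    · rintro ⟨n, b, hb⟩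
      exact ⟨b, hFW a n b hb⟩
    · rintro ⟨b, hb⟩
      obtain ⟨k, hk⟩ := (hmem _).1 hb
      refine ⟨Nat.pair k (Encodable.encode b), b, ?_⟩
      simp only [F, Nat.unpair_pair, Encodable.encodek, Option.bind_some, hk, cond_true,
        Option.mem_def]
  · obtain ⟨n, hn⟩ := Nat.rfindOpt_spec hb
    exact hFW a n b hn

theorem REPred.and {p q : α → Prop} (hp : REPred p) (hq : REPred q) :
    REPred fun a => p a ∧ q a := by
  refine (Partrec.bind hp (hq.comp Computable.fst).to₂).dom_re.of_eq fun a => ?_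
  simp [Part.bind_dom, Part.assert]

theorem REPred.comp {p : β → Prop} (hp : REPred p) {f : α → β} (hf : Computable f) :
    REPred fun a => p (f a) :=
  Partrec.comp hp hf

end

/-! ### Running times are partial computable. -/

namespace Turing.PartrecToTM2

noncomputable instance : Primcodable Γ' := Primcodable.ofEquiv (Fin (Fintype.card Γ')) (Fintype.equivFin Γ')

/-- The contents of four stacks as a tuple. -/
abbrev StackTuple := List Γ' × List Γ' × List Γ' × List Γ'

namespace StackTuple

def toFun (p : StackTuple) : K' → List Γ' := K'.elim p.1 p.2.1 p.2.2.1 p.2.2.2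

def ofFun (S : K' → List Γ') : StackTuple := (S .main, S .rev, S .aux, S .stack)

theorem toFun_ofFun (S : K' → List Γ') : toFun (ofFun S) = S := by
  funext k; cases k <;> rfl

theorem primrec_toFun (k : K') : Primrec fun p : StackTuple => p.toFun k := by
  cases k
  · exact Primrec.fst
  · exact Primrec.fst.comp Primrec.snd
  · exact Primrec.fst.comp (Primrec.snd.comp Primrec.snd)
  · exact Primrec.snd.comp (Primrec.snd.comp Primrec.snd)

theorem primrec_update (k : K') {f : StackTuple → List Γ'} (hf : Primrec f) :
    Primrec fun p : StackTuple => ofFun (update p.toFun k (f p)) := by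
  have h : ∀ k', Primrec fun p : StackTuple => update p.toFun k (f p) k' := by
    intro k'
    by_cases hk : k' = k
    · subst hk; simpa using hf
    · simpa [hk] using primrec_toFun k'
  exact Primrec.pair (h _) (Primrec.pair (h _) (Primrec.pair (h _) (h _)))

end StackTuple

open TM2 StackTuple

variable {Λ σ : Type} [Primcodable Λ] [Primcodable σ]

/-- The components of a configuration. -/
def cfgTuple (c : Cfg (fun _ : K' => Γ') Λ σ) : (Option Λ × σ) × StackTuple :=
  ((c.l, c.var), ofFun c.stk)

/-- For a fixed statement and state, the only data-dependent choice is the letter read, and it has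
finitely many values. -/
theorem primrec_stepAux (q : Stmt (fun _ : K' => Γ') Λ σ) (v : σ) :
    Primrec fun p : StackTuple => cfgTuple (stepAux q v p.toFun) := by
  have : Inhabited σ := ⟨v⟩
  have hcase : ∀ (k : K') (F : Option Γ' → StackTuple → (Option Λ × σ) × StackTuple),
      (∀ o, Primrec (F o)) → Primrec fun p : StackTuple => F (p.toFun k).head? p := by
    intro k F hF
    exact (Primrec.of_finite_left hF).comp (Primrec.list_head?.comp (primrec_toFun k)) Primrec.id
  induction q generalizing v with
  | push k f q ih =>
    have := (ih v).comp (primrec_update k (Primrec.list_cons.comp (Primrec.const (f v))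
      (primrec_toFun k)))
    simp only [toFun_ofFun] at this
    exact this
  | peek k f q ih =>
    exact hcase k (fun o p => cfgTuple (stepAux q (f v o) p.toFun)) fun o => ih _
  | pop k f q ih =>
    refine hcase k (fun o p => cfgTuple (stepAux q (f v o) (update p.toFun k (p.toFun k).tail)))
      fun o => ?_
    have := (ih (f v o)).comp (primrec_update k (Primrec.list_tail.comp (primrec_toFun k)))
    simpa only [toFun_ofFun] using this
  | load f q ih => exact ih _
  | branch f q₁ q₂ ih₁ ih₂ =>
    simp only [stepAux]
    cases f v
    · exact ih₂ v
    · exact ih₁ v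
  | goto f =>
    exact Primrec.pair (Primrec.const (some (f v), v)) Primrec.id
  | halt => exact Primrec.pair (Primrec.const (none, v)) Primrec.id

/-- The number of steps of a machine over finite alphabets is partial computable in its input. -/
theorem exists_partrec_steps [Finite Λ] [Finite σ] [Inhabited σ]
    (m : Λ → Stmt (fun _ : K' => Γ') Λ σ) (l₀ : Λ) (v₀ : σ) :
    ∃ T : List Γ' →. ℕ, Partrec T ∧ ∀ L n c, c.l = none →
      Steps m n ⟨some l₀, v₀, K'.elim L [] [] []⟩ c → n ∈ T L := by
  -- Halted configurations stay fixed, which makes the iteration total.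
  let next : Option Λ × σ → StackTuple → (Option Λ × σ) × StackTuple := fun q p =>
    match q with
    | (none, v) => ((none, v), p)
    | (some l, v) => cfgTuple (stepAux (m l) v p.toFun)
  have hnext : Primrec₂ next := by
    refine Primrec.of_finite_left ?_
    rintro ⟨_ | l, v⟩
    · exact Primrec.pair (Primrec.const _) Primrec.id
    · exact primrec_stepAux _ _
  let run : List Γ' → ℕ → (Option Λ × σ) × StackTuple := fun L n =>
    (fun c => next c.1 c.2)^[n] ((some l₀, v₀), (L, [], [], []))
  have hrun : Primrec₂ run := by
    refine Primrec.nat_iterate Primrec.snd (Primrec.pair (Primrec.const _)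
      (Primrec.pair Primrec.fst (Primrec.const _))) ?_
    exact hnext.comp (Primrec.fst.comp Primrec.snd) (Primrec.snd.comp Primrec.snd)
  have hstep : ∀ c d, step m c = some d →
      next (cfgTuple c).1 (cfgTuple c).2 = cfgTuple d ∧ c.l ≠ none := by
    rintro ⟨_ | l, v, S⟩ d h
    · simp at h
    · simp only [step, Option.some.injEq] at h
      subst h
      simp [next, cfgTuple, toFun_ofFun]
  -- The run halts at time `n` and not before, so the least halting time found by `Nat.rfind` is
  -- `n`.
  have key : ∀ n c d, d.l = none → Steps m n c d →
      (((fun c => next c.1 c.2)^[n] (cfgTuple c)).1.1 = none ∧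
        ∀ k < n, ((fun c => next c.1 c.2)^[k] (cfgTuple c)).1.1 ≠ none) := by
    intro n
    induction n with
    | zero =>
      rintro c d hd ⟨⟩
      exact ⟨hd, by simp⟩
    | succ n ih =>
      rintro c d hd ⟨e, he, h⟩
      obtain ⟨h₁, h₂⟩ := hstep c e he
      obtain ⟨h₃, h₄⟩ := ih e d hd h
      refine ⟨by simpa [h₁] using h₃, fun k hk => ?_⟩
      cases k with
      | zero => exact h₂
      | succ k => simpa [h₁] using h₄ k (by omega)
  refine ⟨fun L => Nat.rfind fun n => Part.some (run L n).1.1.isNone, ?_, ?_⟩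
  · refine Partrec.rfind (Computable.partrec ?_)
    have : Primrec fun o : Option Λ => o.isNone := Primrec.dom_finite _
    exact (this.comp (Primrec.fst.comp (Primrec.fst.comp hrun))).to_comp
  · intro L n c hc h
    obtain ⟨h₁, h₂⟩ := key n _ c hc h
    refine Nat.mem_rfind.2 ⟨?_, fun {k} hk => ?_⟩
    · exact Part.mem_some_iff.2 (Option.isNone_iff_eq_none.2 h₁).symm
    · refine Part.mem_some_iff.2 ?_
      exact (Option.isNone_eq_false_iff.2 (Option.isSome_iff_ne_none.2 (h₂ k hk))).symm

end Turing.PartrecToTM2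

/-! ### Finite machines for partial recursive functions. -/

namespace Turing.PartrecToTM2

open TM2

/-- A machine with finitely many labels, together with its running time, for a partial recursive
function on the natural numbers. -/
theorem exists_module_of_partrec {h : ℕ →. ℕ} (hh : Partrec h) :
    ∃ (M : Module (fun _ : K' => Γ') (Option Γ')) (T : List Γ' →. ℕ), Partrec T ∧
      ∀ x, ∀ y ∈ h x, ∃ n ∈ T (trList [x]),
        M.Runs none n (K'.elim (trList [x]) [] [] []) (K'.elim (trList [y]) [] [] []) := by
  obtain ⟨c, hc⟩ := ToPartrec.Code.exists_code (Nat.Partrec'.part_iff₁.2 hh)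
  let S := codeSupp c Cont'.halt
  have hS : trNormal c Cont'.halt ∈ S := (tr_supports c Cont'.halt).1
  -- Only labels in the finite support `S` are ever reached; the value elsewhere is arbitrary.
  let ρ : Λ' → S := fun l => if h : l ∈ S then ⟨l, h⟩ else ⟨_, hS⟩
  let M : Module (fun _ : K' => Γ') (Option Γ') :=
    { Λ := S
      main := ρ (trNormal c Cont'.halt)
      m := fun l => (tr l).lift id id (fun a _ => a) ρ none }
  let e : S ≃ Fin (Fintype.card S) := Fintype.equivFin S
  let e' : Option Γ' ≃ Fin (Fintype.card (Option Γ')) := Fintype.equivFin _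
  let : Primcodable S := Primcodable.ofEquiv _ e
  let : Primcodable (Option Γ') := Primcodable.ofEquiv _ e'
  obtain ⟨T, hT, hTM⟩ := exists_partrec_steps M.m M.main none
  refine ⟨M, T, hT, fun x y hy => ?_⟩
  have hmem : halt [y] ∈ StateTransition.eval (TM2.step tr) (init c [x]) := by
    rw [tr_eval]
    have := hc ⟨[x], rfl⟩
    simp only at this
    rw [this]
    exact Part.mem_map _ (Part.mem_map _ hy)
  obtain ⟨n, hn⟩ := exists_steps_of_reaches (StateTransition.mem_eval.1 hmem).1
  have h₁ := Steps.lift (ι := id) (get := id) (set := fun a _ => a) (ρ := ρ)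
    (ex := none) (m' := M.m) (P := (S : Set Λ')) injective_id
    (fun _ _ => rfl) (fun _ _ _ => rfl) (s₀ := none) (T₀ := K'.elim (trList [x]) [] [] [])
    (fun l hl => ?_) (fun l hl v Z l' hl' => ?_) (fun l hl => ?_)
    (d := ⟨some M.main, none, K'.elim (trList [x]) [] [] []⟩)
    ⟨rfl, rfl, fun _ => rfl, fun _ _ => rfl⟩ hn
  · obtain ⟨⟨l₁, v₁, S₁⟩, hs₁, a₁, b₁, c₁, -⟩ := h₁
    obtain rfl : S₁ = K'.elim (trList [y]) [] [] [] := funext c₁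
    replace a₁ : l₁ = none := a₁
    replace b₁ : v₁ = none := b₁
    subst a₁ b₁
    exact ⟨n, hTM _ n _ rfl hs₁, hs₁⟩
  · simp only [Finset.mem_coe] at hl
    simp [M, ρ, hl]
  · let : Inhabited Λ' := ⟨trNormal c Cont'.halt⟩
    have := step_supports tr (tr_supports c Cont'.halt) (c := ⟨some l, v, Z⟩) rfl
      (Finset.some_mem_insertNone.2 hl)
    rw [Option.mem_def.1 hl'] at this
    exact Finset.some_mem_insertNone.1 this
  · cases hl
    exact hS

/-- The number with binary digits `L` followed by a leading one. -/
def bitsNat (L : List Γ') : ℕ :=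
  L.foldr (fun b n => 2 * n + if b = .bit1 then 1 else 0) 1

theorem primrec_bitsNat : Primrec bitsNat := by
  refine Primrec.list_foldr (f := id) (g := fun _ => 1)
    (h := fun _ q => 2 * q.2 + if q.1 = Γ'.bit1 then 1 else 0) Primrec.id (Primrec.const 1) ?_
  refine Primrec.nat_add.comp (Primrec.nat_mul.comp (Primrec.const 2)
    (Primrec.snd.comp Primrec.snd)) ?_
  have : Primrec fun b : Γ' => if b = .bit1 then 1 else 0 := Primrec.dom_finite _
  exact this.comp (Primrec.fst.comp Primrec.snd)

/-- Digits are written with the least significant first. The leading one protects zeros at the end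
of `L`, so every bit string is represented by a number. -/
theorem trNat_bitsNat {L : List Γ'} (hL : ∀ b ∈ L, b = .bit0 ∨ b = .bit1) :
    trNat (bitsNat L) = L ++ [.bit1] := by
  suffices h : ∃ p : PosNum, (p : ℕ) = bitsNat L ∧ trPosNum p = L ++ [.bit1] by
    obtain ⟨p, hp, hp'⟩ := h
    rw [← hp, ← hp', trNat]
    exact congrArg trNum (Num.of_to_nat (Num.pos p))
  induction L with
  | nil => exact ⟨PosNum.one, rfl, rfl⟩
  | cons b L ih =>
    obtain ⟨p, hp, hp'⟩ := ih fun b hb => hL b (by simp [hb])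
    obtain rfl | rfl := hL b (by simp)
    · refine ⟨p.bit0, ?_, by simp [trPosNum, hp']⟩
      rw [PosNum.cast_bit0, hp]
      simp [bitsNat]; omega
    · refine ⟨p.bit1, ?_, by simp [trPosNum, hp']⟩
      rw [PosNum.cast_bit1, hp]
      simp [bitsNat]; omega

/-! ### Words as bit strings. -/

section Words

variable {α : Type} [Fintype α] [DecidableEq α]

/-- The indicator of a letter in an enumeration of the alphabet. -/
def indicator (as : List α) (a : α) : List Γ' :=
  as.map fun b => if a = b then .bit1 else .bit0

/-- A letter as a block of bits of fixed length. -/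
noncomputable def letterCode (a : α) : List Γ' := .bit0 :: indicator Finset.univ.toList a

noncomputable def wordCode (w : List α) : List Γ' := w.flatMap letterCode

/-- Every letter block starts with `bit0`, so a `bit1` at a block boundary acts as a separator. -/
noncomputable def pairCode (p : List α × List α) : List Γ' :=
  wordCode p.1 ++ .bit1 :: wordCode p.2

@[simp]
theorem wordCode_nil : wordCode ([] : List α) = [] := rfl

@[simp]
theorem wordCode_cons (a : α) (w : List α) :
    wordCode (a :: w) = .bit0 :: (indicator Finset.univ.toList a ++ wordCode w) := rfl

theorem mem_wordCode {w : List α} : ∀ b ∈ wordCode w, b = .bit0 ∨ b = .bit1 := by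
  intro b hb
  simp only [wordCode, letterCode, indicator, List.mem_flatMap, List.mem_cons, List.mem_map] at hb
  obtain ⟨a, -, rfl | ⟨c, -, rfl⟩⟩ := hb
  · exact .inl rfl
  · split_ifs
    · exact .inr rfl
    · exact .inl rfl

theorem mem_pairCode {p : List α × List α} : ∀ b ∈ pairCode p, b = .bit0 ∨ b = .bit1 := by
  intro b hb
  simp only [pairCode, List.mem_append, List.mem_cons] at hb
  obtain hb | rfl | hb := hb
  · exact mem_wordCode b hb
  · exact .inr rfl
  · exact mem_wordCode b hb

theorem indicator_injective : Injective (indicator (Finset.univ.toList : List α)) := by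
  intro a b h
  have := List.map_inj_left.1 h b (by simp)
  by_contra hab
  simp [hab] at this

/-- The first bit tells whether another letter follows, and blocks have equal length, so both
strings are parsed in the same way. -/
theorem wordCode_append_inj {u v : List α} {s t : List Γ'} (hs : s.head? ≠ some .bit0)
    (ht : t.head? ≠ some .bit0) (h : wordCode u ++ s = wordCode v ++ t) : u = v ∧ s = t := by
  induction u generalizing v with
  | nil =>
    cases v with
    | nil => exact ⟨rfl, h⟩
    | cons b v => simp at h; simp [h] at hs
  | cons a u ih =>
    cases v with
    | nil => simp at h; simp [← h] at ht
    | cons b v =>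
      simp only [wordCode_cons, List.cons_append, List.append_assoc, List.cons.injEq,
        true_and] at h
      obtain ⟨h₁, h₂⟩ := List.append_inj h (by simp [indicator])
      obtain ⟨rfl, rfl⟩ := ih h₂
      exact ⟨by rw [indicator_injective h₁], rfl⟩

theorem bitsNat_pairCode_injective : Injective fun p : List α × List α => bitsNat (pairCode p) := by
  rintro ⟨u, v⟩ ⟨u', v'⟩ h
  have h' := congrArg trNat h
  simp only [trNat_bitsNat mem_pairCode, List.append_cancel_right_eq] at h'
  obtain ⟨rfl, h'⟩ := wordCode_append_inj (by simp) (by simp) h'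
  simp only [List.cons.injEq, true_and] at h'
  obtain ⟨rfl, -⟩ := wordCode_append_inj (s := []) (t := []) (by simp) (by simp) (by simpa using h')
  rfl

variable [Primcodable α]

theorem primrec_wordCode : Primrec (wordCode (α := α)) :=
  Primrec.list_flatMap Primrec.id ((Primrec.dom_finite letterCode).comp Primrec.snd).to₂

theorem primrec_pairCode : Primrec (pairCode (α := α)) :=
  Primrec.list_append.comp (primrec_wordCode.comp Primrec.fst)
    (Primrec.list_cons.comp (Primrec.const _) (primrec_wordCode.comp Primrec.snd))

/-- A machine with finitely many labels, together with its running time, for a partial computable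
function on pairs of words. -/
theorem exists_module_of_partrec_words {g : List α × List α →. List α} (hg : Partrec g) :
    ∃ (M : Module (fun _ : K' => Γ') (Option Γ')) (T : List α × List α →. ℕ), Partrec T ∧
      ∀ p, ∀ w ∈ g p, ∃ n ∈ T p,
        M.Runs none n (K'.elim (pairCode p ++ [.bit1, .cons]) [] [] [])
          (K'.elim (wordCode w ++ [.bit1, .cons]) [] [] []) := by
  -- No decoder is written: a selector for the graph of the encoding inverts it, by injectivity.
  have hW : REPred fun q : ℕ × (List α × List α) => bitsNat (pairCode q.2) = q.1 := by
    refine ComputablePred.to_re ?_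
    exact (PrimrecRel.comp Primrec.eq ((primrec_bitsNat.comp primrec_pairCode).comp Primrec.snd)
      Primrec.fst).computablePred
  obtain ⟨d, hd, hdom, hdspec⟩ := hW.exists_selector
  have hdmem : ∀ p, p ∈ d (bitsNat (pairCode p)) := by
    intro p
    obtain ⟨q, hq⟩ := Part.dom_iff_mem.1 ((hdom (bitsNat (pairCode p))).2 ⟨p, rfl⟩)
    rwa [bitsNat_pairCode_injective (a₁ := q) (a₂ := p) (hdspec _ _ hq)] at hq
  have hh : Partrec fun n => (d n).bind fun p => (g p).map fun w => bitsNat (wordCode w) := by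
    refine hd.bind ?_
    exact (hg.comp Computable.snd).map
      ((primrec_bitsNat.comp primrec_wordCode).to_comp.comp Computable.snd).to₂
  obtain ⟨M, T, hT, hM⟩ := exists_module_of_partrec hh
  refine ⟨M, fun p => T (pairCode p ++ [.bit1, .cons]), ?_, ?_⟩
  · exact hT.comp (Primrec.list_append.comp primrec_pairCode (Primrec.const _)).to_comp
  · intro p w hw
    have := hM (bitsNat (pairCode p)) (bitsNat (wordCode w))
      (Part.mem_bind (hdmem p) (Part.mem_map _ hw))
    simpa [trNat_bitsNat mem_pairCode, trNat_bitsNat mem_wordCode] using this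

end Words

end Turing.PartrecToTM2

/-! ### Stacks and loops of the composed machine. -/

namespace Turing.SliceComposition

open TM2 PartrecToTM2

/-- The auxiliary stacks of the machine that composes two reductions. -/
inductive Register
  | inp | r₁ | r₂ | r₃ | tmp
  deriving DecidableEq

instance : Fintype Register :=
  ⟨{.inp, .r₁, .r₂, .r₃, .tmp}, by rintro (_ | _ | _ | _ | _) <;> decide⟩

/-- The contents of the auxiliary stacks. -/
def regs {Γ : Type} (i a b c e : List (Option Γ)) : Register → List (Option Γ)
  | .inp => i
  | .r₁ => a
  | .r₂ => b
  | .r₃ => c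
  | .tmp => e

section Regs

variable {Γ : Type} (i a b c e x : List (Option Γ))

@[simp] theorem regs_inp : regs i a b c e .inp = i := rfl
@[simp] theorem regs_r₁ : regs i a b c e .r₁ = a := rfl
@[simp] theorem regs_r₂ : regs i a b c e .r₂ = b := rfl
@[simp] theorem regs_r₃ : regs i a b c e .r₃ = c := rfl
@[simp] theorem regs_tmp : regs i a b c e .tmp = e := rfl

@[simp] theorem update_regs_inp : update (regs i a b c e) .inp x = regs x a b c e := by
  funext k; cases k <;> rfl
@[simp] theorem update_regs_r₁ : update (regs i a b c e) .r₁ x = regs i x b c e := by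
  funext k; cases k <;> rfl
@[simp] theorem update_regs_r₂ : update (regs i a b c e) .r₂ x = regs i a x c e := by
  funext k; cases k <;> rfl
@[simp] theorem update_regs_r₃ : update (regs i a b c e) .r₃ x = regs i a b x e := by
  funext k; cases k <;> rfl
@[simp] theorem update_regs_tmp : update (regs i a b c e) .tmp x = regs i a b c x := by
  funext k; cases k <;> rfl

end Regs

/-- Stacks that are empty with one exception. -/
def single {K : Type} [DecidableEq K] {Γ : K → Type} (k : K) (L : List (Γ k)) : ∀ k, List (Γ k) :=
  update (fun _ => []) k L

section Single

variable {K : Type} [DecidableEq K] {Γ : K → Type} (k : K) (L L' : List (Γ k))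

@[simp] theorem single_self : single k L k = L := update_self ..

@[simp] theorem update_single : update (single k L) k L' = single k L' := update_idem ..

@[simp] theorem single_nil : single k ([] : List (Γ k)) = fun _ => [] := update_eq_self k _

end Single

section Machine

variable {K₁ K₂ : Type} [DecidableEq K₁] [DecidableEq K₂]

/-- The stacks of the composed machine: those of the two machines, those of the machine for a
partial computable function, and the auxiliary ones. -/
abbrev StackIndex (K₁ K₂ : Type) : Type := (K₁ ⊕ K₂) ⊕ (K' ⊕ Register)

@[reducible]
def StackAlphabet (Γ₁ : K₁ → Type) (Γ₂ : K₂ → Type) (Γ : Type) : StackIndex K₁ K₂ → Type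
  | .inl (.inl k) => Γ₁ k
  | .inl (.inr k) => Γ₂ k
  | .inr (.inl _) => Γ'
  | .inr (.inr _) => Option Γ

/-- The internal states of the composed machine: those of the three machines and a letter. -/
abbrev Store (σ₁ σ₂ Γ : Type) : Type := σ₁ × σ₂ × Option Γ' × Option Γ

def setBuf {σ₁ σ₂ Γ : Type} (s : Store σ₁ σ₂ Γ) (o : Option Γ) : Store σ₁ σ₂ Γ :=
  (s.1, s.2.1, s.2.2.1, o)

def setBit {σ₁ σ₂ Γ : Type} (s : Store σ₁ σ₂ Γ) (o : Option Γ') : Store σ₁ σ₂ Γ :=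
  (s.1, s.2.1, o, s.2.2.2)

variable {Γ₁ : K₁ → Type} {Γ₂ : K₂ → Type} {Γ : Type} {σ₁ σ₂ : Type}

/-- The contents of all stacks. -/
def stk (S₁ : ∀ k, List (Γ₁ k)) (S₂ : ∀ k, List (Γ₂ k)) (P : K' → List Γ')
    (R : Register → List (Option Γ)) : ∀ k, List (StackAlphabet Γ₁ Γ₂ Γ k)
  | .inl (.inl k) => S₁ k
  | .inl (.inr k) => S₂ k
  | .inr (.inl k) => P k
  | .inr (.inr k) => R k

/-- Statements of the loops of the composed machine. -/
abbrev LoopStmt (Γ₁ : K₁ → Type) (Γ₂ : K₂ → Type) (Γ σ₁ σ₂ : Type) : Type :=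
  Stmt (StackAlphabet Γ₁ Γ₂ Γ) Unit (Store σ₁ σ₂ Γ)

section StepAux

variable (q : LoopStmt Γ₁ Γ₂ Γ σ₁ σ₂) (s : Store σ₁ σ₂ Γ) (S₁ : ∀ k, List (Γ₁ k))
  (S₂ : ∀ k, List (Γ₂ k)) (P : K' → List Γ') (R : Register → List (Option Γ))

/-- These wrappers fix the block of stacks acted on, so that simplification keeps stack contents in
the form `stk`. -/
def push₁ (k : K₁) (f : Store σ₁ σ₂ Γ → Γ₁ k) : LoopStmt Γ₁ Γ₂ Γ σ₁ σ₂ :=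
  .push (.inl (.inl k)) f q

def pop₁ (k : K₁) (f : Store σ₁ σ₂ Γ → Option (Γ₁ k) → Store σ₁ σ₂ Γ) :
    LoopStmt Γ₁ Γ₂ Γ σ₁ σ₂ :=
  .pop (.inl (.inl k)) f q

def push₂ (k : K₂) (f : Store σ₁ σ₂ Γ → Γ₂ k) : LoopStmt Γ₁ Γ₂ Γ σ₁ σ₂ :=
  .push (.inl (.inr k)) f q

def pushMain (f : Store σ₁ σ₂ Γ → Γ') : LoopStmt Γ₁ Γ₂ Γ σ₁ σ₂ :=
  .push (.inr (.inl .main)) f q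

def popMain (f : Store σ₁ σ₂ Γ → Option Γ' → Store σ₁ σ₂ Γ) : LoopStmt Γ₁ Γ₂ Γ σ₁ σ₂ :=
  .pop (.inr (.inl .main)) f q

def pushReg (k : Register) (f : Store σ₁ σ₂ Γ → Option Γ) : LoopStmt Γ₁ Γ₂ Γ σ₁ σ₂ :=
  .push (.inr (.inr k)) f q

def popReg (k : Register) (f : Store σ₁ σ₂ Γ → Option (Option Γ) → Store σ₁ σ₂ Γ) :
    LoopStmt Γ₁ Γ₂ Γ σ₁ σ₂ :=
  .pop (.inr (.inr k)) f q

theorem update_stk₁ (k : K₁) (L : List (Γ₁ k)) :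
    update (stk S₁ S₂ P R) (.inl (.inl k)) L = stk (update S₁ k L) S₂ P R := by
  funext k'
  obtain (k' | k') | (k' | k') := k'
  · by_cases h : k' = k
    · subst h; simp [stk]
    · rw [update_of_ne (by simpa using h)]; simp [stk, h]
  all_goals rfl

theorem update_stk₂ (k : K₂) (L : List (Γ₂ k)) :
    update (stk S₁ S₂ P R) (.inl (.inr k)) L = stk S₁ (update S₂ k L) P R := by
  funext k'
  obtain (k' | k') | (k' | k') := k'
  rotate_left
  · by_cases h : k' = k
    · subst h; simp [stk]
    · rw [update_of_ne (by simpa using h)]; simp [stk, h]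
  all_goals rfl

theorem update_stk_main (k : K') (L : List Γ') :
    update (stk S₁ S₂ P R) (.inr (.inl k)) L = stk S₁ S₂ (update P k L) R := by
  funext k'
  obtain (k' | k') | (k' | k') := k'
  rotate_left 2
  · by_cases h : k' = k
    · subst h; simp [stk]
    · rw [update_of_ne (by simpa using h)]; simp [stk, h]
  all_goals rfl

theorem update_stk_reg (k : Register) (L : List (Option Γ)) :
    update (stk S₁ S₂ P R) (.inr (.inr k)) L = stk S₁ S₂ P (update R k L) := by
  funext k'
  obtain (k' | k') | (k' | k') := k'
  rotate_left 3
  · by_cases h : k' = k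
    · subst h; simp [stk]
    · rw [update_of_ne (by simpa using h)]; simp [stk, h]
  all_goals rfl

@[simp] theorem stepAux_push₁ (k f) : stepAux (push₁ q k f) s (stk S₁ S₂ P R) =
    stepAux q s (stk (update S₁ k (f s :: S₁ k)) S₂ P R) :=
  congrArg (stepAux q s) (update_stk₁ ..)

@[simp] theorem stepAux_pop₁ (k f) : stepAux (pop₁ q k f) s (stk S₁ S₂ P R) =
    stepAux q (f s (S₁ k).head?) (stk (update S₁ k (S₁ k).tail) S₂ P R) :=
  congrArg (stepAux q (f s (S₁ k).head?)) (update_stk₁ ..)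

@[simp] theorem stepAux_push₂ (k f) : stepAux (push₂ q k f) s (stk S₁ S₂ P R) =
    stepAux q s (stk S₁ (update S₂ k (f s :: S₂ k)) P R) :=
  congrArg (stepAux q s) (update_stk₂ ..)

@[simp] theorem stepAux_pushMain (f) : stepAux (pushMain q f) s (stk S₁ S₂ P R) =
    stepAux q s (stk S₁ S₂ (update P .main (f s :: P .main)) R) :=
  congrArg (stepAux q s) (update_stk_main ..)

@[simp] theorem stepAux_popMain (f) : stepAux (popMain q f) s (stk S₁ S₂ P R) =
    stepAux q (f s (P .main).head?) (stk S₁ S₂ (update P .main (P .main).tail) R) :=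
  congrArg (stepAux q (f s (P .main).head?)) (update_stk_main ..)

@[simp] theorem stepAux_pushReg (k f) : stepAux (pushReg q k f) s (stk S₁ S₂ P R) =
    stepAux q s (stk S₁ S₂ P (update R k (f s :: R k))) :=
  congrArg (stepAux q s) (update_stk_reg ..)

@[simp] theorem stepAux_popReg (k f) : stepAux (popReg q k f) s (stk S₁ S₂ P R) =
    stepAux q (f s (R k).head?) (stk S₁ S₂ P (update R k (R k).tail)) :=
  congrArg (stepAux q (f s (R k).head?)) (update_stk_reg ..)

end StepAux

/-- Read a letter from an auxiliary stack into the buffer. -/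
def readReg (k : Register) (q : LoopStmt Γ₁ Γ₂ Γ σ₁ σ₂) : LoopStmt Γ₁ Γ₂ Γ σ₁ σ₂ :=
  -- `join` identifies an empty stack with a separator on top, so a loop stops at either, and the
  -- separator is consumed.
  popReg q k fun s o => setBuf s o.join

/-- Write the buffer to an auxiliary stack. -/
def writeReg (k : Register) (q : LoopStmt Γ₁ Γ₂ Γ σ₁ σ₂) : LoopStmt Γ₁ Γ₂ Γ σ₁ σ₂ :=
  pushReg q k fun s => s.2.2.2

/-- Repeat reading a letter by `read` and writing it by `write` until there is none; then do `fin`. -/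
def transfer (read write fin : LoopStmt Γ₁ Γ₂ Γ σ₁ σ₂ → LoopStmt Γ₁ Γ₂ Γ σ₁ σ₂) :
    Module (StackAlphabet Γ₁ Γ₂ Γ) (Store σ₁ σ₂ Γ) :=
  .loop <| read <| .branch (fun s => s.2.2.2.isSome)
    (write <| .load (fun s => setBuf s none) <| .goto fun _ => ()) (fin .halt)

section Code

variable [DecidableEq Γ]

/-- The tail is pushed first, so that the bits appear on the stack in the order of the list. -/
def pushIndicator : List Γ → LoopStmt Γ₁ Γ₂ Γ σ₁ σ₂ → LoopStmt Γ₁ Γ₂ Γ σ₁ σ₂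
  | [], q => q
  | a :: as, q => pushIndicator as <| pushMain q fun s =>
      if s.2.2.2 = some a then .bit1 else .bit0

def popIndicator : List Γ → LoopStmt Γ₁ Γ₂ Γ σ₁ σ₂ → LoopStmt Γ₁ Γ₂ Γ σ₁ σ₂
  | [], q => q
  | a :: as, q => popMain (popIndicator as q) fun s o =>
      if o = some .bit1 then setBuf s (some a) else s

variable {q : LoopStmt Γ₁ Γ₂ Γ σ₁ σ₂} {s₁ : σ₁} {s₂ : σ₂} {S₁ : ∀ k, List (Γ₁ k)}
  {S₂ : ∀ k, List (Γ₂ k)} {R : Register → List (Option Γ)}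

theorem stepAux_pushIndicator (as : List Γ) (a : Γ) (g : Option Γ') (L : List Γ') :
    stepAux (pushIndicator as q) (s₁, s₂, g, some a) (stk S₁ S₂ (K'.elim L [] [] []) R) =
      stepAux q (s₁, s₂, g, some a) (stk S₁ S₂ (K'.elim (indicator as a ++ L) [] [] []) R) := by
  induction as generalizing q with
  | nil => rfl
  | cons b as ih => simp [pushIndicator, ih, indicator]

theorem stepAux_popIndicator (as : List Γ) (a : Γ) (g : Option Γ') (o : Option Γ) (L : List Γ') :
    stepAux (popIndicator as q) (s₁, s₂, g, o)
        (stk S₁ S₂ (K'.elim (indicator as a ++ L) [] [] []) R) =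
      stepAux q (s₁, s₂, g, if a ∈ as then some a else o)
        (stk S₁ S₂ (K'.elim L [] [] []) R) := by
  induction as generalizing o with
  | nil => simp [popIndicator, indicator]
  | cons b as ih =>
    have : indicator (b :: as) a = (if a = b then .bit1 else .bit0) :: indicator as a := rfl
    by_cases h : a = b
    · subst h; simp [popIndicator, this, setBuf, ih]
    · simp [popIndicator, this, h, ih]

variable [Fintype Γ]

/-- Write the code of the letter in the buffer. -/
noncomputable def writeCode (q : LoopStmt Γ₁ Γ₂ Γ σ₁ σ₂) : LoopStmt Γ₁ Γ₂ Γ σ₁ σ₂ :=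
  pushIndicator Finset.univ.toList <| pushMain q fun _ => .bit0

/-- Read the code of a letter or the end mark. -/
noncomputable def readCode (q : LoopStmt Γ₁ Γ₂ Γ σ₁ σ₂) : LoopStmt Γ₁ Γ₂ Γ σ₁ σ₂ :=
  popMain (.branch (fun s => s.2.2.1 = some Γ'.bit0)
    (popIndicator Finset.univ.toList <| .load (fun s => setBit s none) q)
    -- At the end mark `bit1`, the second pop removes the terminator `cons`.
    (popMain q fun s _ => setBit s none)) fun s o => setBit s o

@[simp]
theorem stepAux_writeCode (a : Γ) (g : Option Γ') (w : List Γ) (L : List Γ') :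
    stepAux (writeCode q) (s₁, s₂, g, some a)
        (stk S₁ S₂ (K'.elim (wordCode w ++ L) [] [] []) R) =
      stepAux q (s₁, s₂, g, some a) (stk S₁ S₂ (K'.elim (wordCode (a :: w) ++ L) [] [] []) R) := by
  simp [writeCode, stepAux_pushIndicator]

@[simp]
theorem stepAux_readCode_cons (a : Γ) (w : List Γ) (L : List Γ') :
    stepAux (readCode q) (s₁, s₂, none, none)
        (stk S₁ S₂ (K'.elim (wordCode (a :: w) ++ L) [] [] []) R) =
      stepAux q (s₁, s₂, none, some a) (stk S₁ S₂ (K'.elim (wordCode w ++ L) [] [] []) R) := by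
  simp [readCode, stepAux_popIndicator, setBit]

@[simp]
theorem stepAux_readCode_nil :
    stepAux (readCode q) (s₁, s₂, none, none)
        (stk S₁ S₂ (K'.elim [.bit1, .cons] [] [] []) R) =
      stepAux q (s₁, s₂, none, none) (stk S₁ S₂ (K'.elim [] [] [] []) R) := by
  simp [readCode, setBit]

end Code

end Machine

end Turing.SliceComposition

/-! ### Moving words between stacks. -/

namespace Turing.SliceComposition

open TM2 PartrecToTM2

section Transfers

variable {K₁ K₂ : Type} [DecidableEq K₁] [DecidableEq K₂]
  {Γ₁ : K₁ → Type} {Γ₂ : K₂ → Type} {Γ σ₁ σ₂ : Type} {v₁ : σ₁} {v₂ : σ₂}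
  {S₁ : ∀ k, List (Γ₁ k)} {S₂ : ∀ k, List (Γ₂ k)} {P : K' → List Γ'}
  {i a b c e : List (Option Γ)}

theorem transfer_runs
    {read write fin : LoopStmt Γ₁ Γ₂ Γ σ₁ σ₂ → LoopStmt Γ₁ Γ₂ Γ σ₁ σ₂} {s : Store σ₁ σ₂ Γ}
    (St : List Γ → List Γ → ∀ k, List (StackAlphabet Γ₁ Γ₂ Γ k))
    (T : List Γ → ∀ k, List (StackAlphabet Γ₁ Γ₂ Γ k))
    (h : ∀ a l acc, stepAux (read <| .branch (fun s => s.2.2.2.isSome)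
      (write <| .load (fun s => setBuf s none) <| .goto fun _ => ()) (fin .halt)) s
      (St (a :: l) acc) = ⟨some (), s, St l (a :: acc)⟩)
    (h₀ : ∀ acc, stepAux (read <| .branch (fun s => s.2.2.2.isSome)
      (write <| .load (fun s => setBuf s none) <| .goto fun _ => ()) (fin .halt)) s
      (St [] acc) = ⟨none, s, T acc⟩) (u : List Γ) :
    (transfer read write fin).Runs s (u.length + 1) (St u []) (T u.reverse) := by
  have := Module.loop_runs h h₀ u []
  rwa [List.append_nil] at this

/-- Each transfer reverses a word; this form serves the second of two transfers, which restores the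
order. -/
theorem transfer_runs_reverse
    {read write fin : LoopStmt Γ₁ Γ₂ Γ σ₁ σ₂ → LoopStmt Γ₁ Γ₂ Γ σ₁ σ₂} {s : Store σ₁ σ₂ Γ}
    (St : List Γ → List Γ → ∀ k, List (StackAlphabet Γ₁ Γ₂ Γ k))
    (T : List Γ → ∀ k, List (StackAlphabet Γ₁ Γ₂ Γ k))
    (h : ∀ a l acc, stepAux (read <| .branch (fun s => s.2.2.2.isSome)
      (write <| .load (fun s => setBuf s none) <| .goto fun _ => ()) (fin .halt)) s
      (St (a :: l) acc) = ⟨some (), s, St l (a :: acc)⟩)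
    (h₀ : ∀ acc, stepAux (read <| .branch (fun s => s.2.2.2.isSome)
      (write <| .load (fun s => setBuf s none) <| .goto fun _ => ()) (fin .halt)) s
      (St [] acc) = ⟨none, s, T acc⟩) (u : List Γ) :
    (transfer read write fin).Runs s (u.length + 1) (St u.reverse []) (T u) := by
  have := transfer_runs St T h h₀ u.reverse
  rwa [List.reverse_reverse, List.length_reverse] at this

theorem runs_readInput (u : List Γ) :
    (transfer (readReg .inp) (writeReg .r₁) id).Runs (v₁, v₂, none, none) (u.length + 1)
      (stk S₁ S₂ P (regs (u.map some ++ none :: i) [] b c e))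
      (stk S₁ S₂ P (regs i (u.reverse.map some) b c e)) := by
  refine transfer_runs
    (fun l acc => stk S₁ S₂ P (regs (l.map some ++ none :: i) (acc.map some) b c e))
    (fun acc => stk S₁ S₂ P (regs i (acc.map some) b c e))
    (fun x l acc => ?_) (fun acc => ?_) u
  · simp [readReg, writeReg, setBuf]
  · simp [readReg, setBuf]

theorem runs_readInput₂ (u : List Γ) :
    (transfer (readReg .inp) (writeReg .r₂)
      (fun q => pushMain (pushMain q fun _ => .bit1) fun _ => .cons)).Runs
      (v₁, v₂, none, none) (u.length + 1)
      (stk S₁ S₂ (K'.elim [] [] [] []) (regs (u.map some ++ none :: i) a [] c e))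
      (stk S₁ S₂ (K'.elim [.bit1, .cons] [] [] []) (regs i a (u.reverse.map some) c e)) := by
  refine transfer_runs
    (fun l acc => stk S₁ S₂ (K'.elim [] [] [] [])
      (regs (l.map some ++ none :: i) a (acc.map some) c e))
    (fun acc => stk S₁ S₂ (K'.elim [.bit1, .cons] [] [] []) (regs i a (acc.map some) c e))
    (fun x l acc => ?_) (fun acc => ?_) u
  · simp [readReg, writeReg, setBuf]
  · simp [readReg, setBuf]

theorem runs_toTmp_inp (u : List Γ) :
    (transfer (readReg .inp) (writeReg .tmp) id).Runs (v₁, v₂, none, none) (u.length + 1)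
      (stk S₁ S₂ P (regs (u.map some) a b c []))
      (stk S₁ S₂ P (regs [] a b c (u.reverse.map some))) := by
  refine transfer_runs
    (fun l acc => stk S₁ S₂ P (regs (l.map some) a b c (acc.map some)))
    (fun acc => stk S₁ S₂ P (regs [] a b c (acc.map some)))
    (fun x l acc => ?_) (fun acc => ?_) u
  · simp [readReg, writeReg, setBuf]
  · simp [readReg, setBuf]

theorem runs_toTmp_r₁ (u : List Γ) :
    (transfer (readReg .r₁) (writeReg .tmp) id).Runs (v₁, v₂, none, none) (u.length + 1)
      (stk S₁ S₂ P (regs i (u.map some) b c []))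
      (stk S₁ S₂ P (regs i [] b c (u.reverse.map some))) := by
  refine transfer_runs
    (fun l acc => stk S₁ S₂ P (regs i (l.map some) b c (acc.map some)))
    (fun acc => stk S₁ S₂ P (regs i [] b c (acc.map some)))
    (fun x l acc => ?_) (fun acc => ?_) u
  · simp [readReg, writeReg, setBuf]
  · simp [readReg, setBuf]

theorem runs_toTmp_r₂ (u : List Γ) :
    (transfer (readReg .r₂) (writeReg .tmp) id).Runs (v₁, v₂, none, none) (u.length + 1)
      (stk S₁ S₂ P (regs i a (u.map some) c []))
      (stk S₁ S₂ P (regs i a [] c (u.reverse.map some))) := by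
  refine transfer_runs
    (fun l acc => stk S₁ S₂ P (regs i a (l.map some) c (acc.map some)))
    (fun acc => stk S₁ S₂ P (regs i a [] c (acc.map some)))
    (fun x l acc => ?_) (fun acc => ?_) u
  · simp [readReg, writeReg, setBuf]
  · simp [readReg, setBuf]

theorem runs_toTmp_r₃ (u : List Γ) :
    (transfer (readReg .r₃) (writeReg .tmp) id).Runs (v₁, v₂, none, none) (u.length + 1)
      (stk S₁ S₂ P (regs i a b (u.map some) []))
      (stk S₁ S₂ P (regs i a b [] (u.reverse.map some))) := by
  refine transfer_runs
    (fun l acc => stk S₁ S₂ P (regs i a b (l.map some) (acc.map some)))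
    (fun acc => stk S₁ S₂ P (regs i a b [] (acc.map some)))
    (fun x l acc => ?_) (fun acc => ?_) u
  · simp [readReg, writeReg, setBuf]
  · simp [readReg, setBuf]

theorem runs_toTmp₁ (k : K₁) (f : Γ₁ k ≃ Γ) (u : List Γ) :
    (transfer (fun q => pop₁ q k fun s o => setBuf s (o.map f)) (writeReg .tmp) id).Runs
      (v₁, v₂, none, none) (u.length + 1)
      (stk (single k (u.map f.symm)) S₂ P (regs i a b c []))
      (stk (fun _ => []) S₂ P (regs i a b c (u.reverse.map some))) := by
  refine transfer_runs
    (fun l acc => stk (single k (l.map f.symm)) S₂ P (regs i a b c (acc.map some)))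
    (fun acc => stk (fun _ => []) S₂ P (regs i a b c (acc.map some)))
    (fun x l acc => ?_) (fun acc => ?_) u
  · simp [writeReg, setBuf]
  · simp [setBuf]

theorem runs_tmpTo₁ (k : K₁) (f : Option Γ → Γ₁ k) (u : List Γ) (L : List (Γ₁ k)) :
    (transfer (readReg .tmp) (fun q => push₁ q k fun s => f s.2.2.2) id).Runs
      (v₁, v₂, none, none) (u.length + 1)
      (stk (single k L) S₂ P (regs i a b c (u.reverse.map some)))
      (stk (single k (u.map (fun x => f (some x)) ++ L)) S₂ P (regs i a b c [])) := by
  refine transfer_runs_reverse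
    (fun l acc => stk (single k (acc.map (fun x => f (some x)) ++ L)) S₂ P
      (regs i a b c (l.map some)))
    (fun acc => stk (single k (acc.map (fun x => f (some x)) ++ L)) S₂ P (regs i a b c []))
    (fun x l acc => ?_) (fun acc => ?_) u
  · simp [readReg, setBuf]
  · simp [readReg, setBuf]

theorem runs_tmpTo₁_sep (k : K₁) (f : Option Γ → Γ₁ k) (u : List Γ) (L : List (Γ₁ k)) :
    (transfer (readReg .tmp) (fun q => push₁ q k fun s => f s.2.2.2)
      (fun q => push₁ q k fun _ => f none)).Runs
      (v₁, v₂, none, none) (u.length + 1)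
      (stk (single k L) S₂ P (regs i a b c (u.reverse.map some)))
      (stk (single k (f none :: (u.map (fun x => f (some x)) ++ L))) S₂ P
        (regs i a b c [])) := by
  refine transfer_runs_reverse
    (fun l acc => stk (single k (acc.map (fun x => f (some x)) ++ L)) S₂ P
      (regs i a b c (l.map some)))
    (fun acc => stk (single k (f none :: (acc.map (fun x => f (some x)) ++ L))) S₂ P
      (regs i a b c []))
    (fun x l acc => ?_) (fun acc => ?_) u
  · simp [readReg, setBuf]
  · simp [readReg, setBuf]

theorem runs_tmpTo₁_sep_r₁ (k : K₁) (f : Option Γ → Γ₁ k) (u : List Γ) (L : List (Γ₁ k)) :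
    (transfer (readReg .tmp) (fun q => push₁ (writeReg .r₁ q) k fun s => f s.2.2.2)
      (fun q => push₁ q k fun _ => f none)).Runs
      (v₁, v₂, none, none) (u.length + 1)
      (stk (single k L) S₂ P (regs i [] b c (u.reverse.map some)))
      (stk (single k (f none :: (u.map (fun x => f (some x)) ++ L))) S₂ P
        (regs i (u.map some) b c [])) := by
  refine transfer_runs_reverse
    (fun l acc => stk (single k (acc.map (fun x => f (some x)) ++ L)) S₂ P
      (regs i (acc.map some) b c (l.map some)))
    (fun acc => stk (single k (f none :: (acc.map (fun x => f (some x)) ++ L))) S₂ P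
      (regs i (acc.map some) b c []))
    (fun x l acc => ?_) (fun acc => ?_) u
  · simp [readReg, writeReg, setBuf]
  · simp [readReg, setBuf]

theorem runs_tmpTo₂ (k : K₂) (f : Option Γ → Γ₂ k) (u : List Γ) (L : List (Γ₂ k)) :
    (transfer (readReg .tmp) (fun q => push₂ q k fun s => f s.2.2.2) id).Runs
      (v₁, v₂, none, none) (u.length + 1)
      (stk S₁ (single k L) P (regs i a b c (u.reverse.map some)))
      (stk S₁ (single k (u.map (fun x => f (some x)) ++ L)) P (regs i a b c [])) := by
  refine transfer_runs_reverse
    (fun l acc => stk S₁ (single k (acc.map (fun x => f (some x)) ++ L)) P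
      (regs i a b c (l.map some)))
    (fun acc => stk S₁ (single k (acc.map (fun x => f (some x)) ++ L)) P (regs i a b c []))
    (fun x l acc => ?_) (fun acc => ?_) u
  · simp [readReg, setBuf]
  · simp [readReg, setBuf]

theorem runs_tmpTo₂_sep (k : K₂) (f : Option Γ → Γ₂ k) (u : List Γ) (L : List (Γ₂ k)) :
    (transfer (readReg .tmp) (fun q => push₂ q k fun s => f s.2.2.2)
      (fun q => push₂ q k fun _ => f none)).Runs
      (v₁, v₂, none, none) (u.length + 1)
      (stk S₁ (single k L) P (regs i a b c (u.reverse.map some)))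
      (stk S₁ (single k (f none :: (u.map (fun x => f (some x)) ++ L))) P
        (regs i a b c [])) := by
  refine transfer_runs_reverse
    (fun l acc => stk S₁ (single k (acc.map (fun x => f (some x)) ++ L)) P
      (regs i a b c (l.map some)))
    (fun acc => stk S₁ (single k (f none :: (acc.map (fun x => f (some x)) ++ L))) P
      (regs i a b c []))
    (fun x l acc => ?_) (fun acc => ?_) u
  · simp [readReg, setBuf]
  · simp [readReg, setBuf]

variable [Fintype Γ] [DecidableEq Γ]

theorem runs_encode_r₂ (u : List Γ) (L : List Γ') :
    (transfer (readReg .r₂) (fun q => writeCode (writeReg .r₃ q))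
      (fun q => pushMain q fun _ => .bit1)).Runs
      (v₁, v₂, none, none) (u.length + 1)
      (stk S₁ S₂ (K'.elim L [] [] []) (regs i a (u.reverse.map some) [] e))
      (stk S₁ S₂ (K'.elim (.bit1 :: (wordCode u ++ L)) [] [] []) (regs i a [] (u.map some) e)) := by
  refine transfer_runs_reverse
    (fun l acc => stk S₁ S₂ (K'.elim (wordCode acc ++ L) [] [] [])
      (regs i a (l.map some) (acc.map some) e))
    (fun acc => stk S₁ S₂ (K'.elim (.bit1 :: (wordCode acc ++ L)) [] [] [])
      (regs i a [] (acc.map some) e))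
    (fun x l acc => ?_) (fun acc => ?_) u
  · simp [readReg, writeReg, setBuf, -wordCode_cons]
  · simp [readReg, setBuf]

theorem runs_encode_r₁ (u : List Γ) (L : List Γ') :
    (transfer (readReg .r₁) (fun q => writeCode (writeReg .r₂ q)) id).Runs
      (v₁, v₂, none, none) (u.length + 1)
      (stk S₁ S₂ (K'.elim L [] [] []) (regs i (u.reverse.map some) [] c e))
      (stk S₁ S₂ (K'.elim (wordCode u ++ L) [] [] []) (regs i [] (u.map some) c e)) := by
  refine transfer_runs_reverse
    (fun l acc => stk S₁ S₂ (K'.elim (wordCode acc ++ L) [] [] [])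
      (regs i (l.map some) (acc.map some) c e))
    (fun acc => stk S₁ S₂ (K'.elim (wordCode acc ++ L) [] [] [])
      (regs i [] (acc.map some) c e))
    (fun x l acc => ?_) (fun acc => ?_) u
  · simp [readReg, writeReg, setBuf, -wordCode_cons]
  · simp [readReg, setBuf]

theorem runs_decode (u : List Γ) :
    (transfer readCode (writeReg .tmp) id).Runs (v₁, v₂, none, none) (u.length + 1)
      (stk S₁ S₂ (K'.elim (wordCode u ++ [.bit1, .cons]) [] [] []) (regs i a b c []))
      (stk S₁ S₂ (K'.elim [] [] [] []) (regs i a b c (u.reverse.map some))) := by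
  refine transfer_runs
    (fun l acc => stk S₁ S₂ (K'.elim (wordCode l ++ [.bit1, .cons]) [] [] [])
      (regs i a b c (acc.map some)))
    (fun acc => stk S₁ S₂ (K'.elim [] [] [] []) (regs i a b c (acc.map some)))
    (fun x l acc => ?_) (fun acc => ?_) u
  · simp [writeReg, setBuf, -wordCode_cons]
  · simp

end Transfers

end Turing.SliceComposition

/-! ### The three phases of the composition. -/

namespace Turing.SliceComposition

open TM2 PartrecToTM2

/-- The program of a bundled machine. -/
def ofFinTM2 (tm : FinTM2) : Module tm.Γ tm.σ :=
  haveI := tm.ΛFin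
  { Λ := tm.Λ, main := tm.main, m := tm.m }

theorem initList_eq (tm : FinTM2) (s : List (tm.Γ tm.k₀)) :
    initList tm s = ⟨some tm.main, tm.initialState, single tm.k₀ s⟩ := by
  refine congrArg (Cfg.mk _ _) (funext fun k => ?_)
  by_cases h : k = tm.k₀
  · subst h; simp
  · simp [h, single]

theorem haltList_eq (tm : FinTM2) (s : List (tm.Γ tm.k₁)) :
    haltList tm s = ⟨none, tm.initialState, single tm.k₁ s⟩ := by
  refine congrArg (Cfg.mk _ _) (funext fun k => ?_)
  by_cases h : k = tm.k₁
  · subst h; simp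
  · simp [h, single]

theorem outputsInTime_iff {tm : FinTM2} {s : List (tm.Γ tm.k₀)} {s' : List (tm.Γ tm.k₁)} {n : ℕ} :
    Nonempty (TM2OutputsInTime tm s (some s') n) ↔
      ∃ N ≤ n, (ofFinTM2 tm).Runs tm.initialState N (single tm.k₀ s) (single tm.k₁ s') := by
  constructor
  · rintro ⟨⟨⟨N, h⟩, hN⟩⟩
    refine ⟨N, hN, ?_⟩
    rw [initList_eq, Option.map_some, haltList_eq] at h
    exact steps_iff_iterate.2 h
  · rintro ⟨N, hN, h⟩
    refine ⟨⟨⟨N, ?_⟩, hN⟩⟩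
    rw [initList_eq, Option.map_some, haltList_eq]
    exact steps_iff_iterate.1 h

section Compose

variable {Γ : Type} (M₁ M₂ : TM2ComputableAux (Option Γ) Γ)
  (G : Module (fun _ : K' => Γ') (Option Γ'))

def embedMain : Module (StackAlphabet M₁.tm.Γ M₂.tm.Γ Γ) (Store M₁.tm.σ M₂.tm.σ Γ) :=
  Module.embed (fun k => .inr (.inl k)) (fun s => s.2.2.1) (fun g s => setBit s g) G

def embed₁ : Module (StackAlphabet M₁.tm.Γ M₂.tm.Γ Γ) (Store M₁.tm.σ M₂.tm.σ Γ) :=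
  Module.embed (fun k => .inl (.inl k)) (fun s => s.1) (fun v s => (v, s.2)) (ofFinTM2 M₁.tm)

def embed₂ : Module (StackAlphabet M₁.tm.Γ M₂.tm.Γ Γ) (Store M₁.tm.σ M₂.tm.σ Γ) :=
  Module.embed (fun k => .inl (.inr k)) (fun s => s.2.1) (fun v s => (s.1, v, s.2.2))
    (ofFinTM2 M₂.tm)

variable {M₁ M₂ G} {n n₁ n₂ : ℕ}

theorem embedMain_runs {L L' : List Γ'}
    (hG : G.Runs none n (K'.elim L [] [] []) (K'.elim L' [] [] [])) {S₁ S₂ R} :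
    (embedMain M₁ M₂ G).Runs (M₁.tm.initialState, M₂.tm.initialState, none, none) n
      (stk S₁ S₂ (K'.elim L [] [] []) R) (stk S₁ S₂ (K'.elim L' [] [] []) R) := by
  unfold embedMain
  refine Module.Runs.embed ?_ ?_ ?_ rfl hG ?_
  · exact fun a b h => by simpa using h
  · exact fun _ _ => rfl
  · exact fun _ _ _ => rfl
  rintro ((k | k) | (k | k)) hk
  · rfl
  · rfl
  · exact absurd ⟨k, rfl⟩ hk
  · rfl

theorem embed₁_runs {T T'} (h₁ : (ofFinTM2 M₁.tm).Runs M₁.tm.initialState n₁ T T') {S₂ P R} :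
    (embed₁ M₁ M₂).Runs (M₁.tm.initialState, M₂.tm.initialState, none, none) n₁
      (stk T S₂ P R) (stk T' S₂ P R) := by
  unfold embed₁
  refine Module.Runs.embed ?_ ?_ ?_ rfl h₁ ?_
  · exact fun a b h => by simpa using h
  · exact fun _ _ => rfl
  · exact fun _ _ _ => rfl
  rintro ((k | k) | (k | k)) hk
  · exact absurd ⟨k, rfl⟩ hk
  all_goals rfl

theorem embed₂_runs {T T'} (h₂ : (ofFinTM2 M₂.tm).Runs M₂.tm.initialState n₂ T T') {S₁ P R} :
    (embed₂ M₁ M₂).Runs (M₁.tm.initialState, M₂.tm.initialState, none, none) n₂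
      (stk S₁ T P R) (stk S₁ T' P R) := by
  unfold embed₂
  refine Module.Runs.embed ?_ ?_ ?_ rfl h₂ ?_
  · exact fun a b h => by simpa using h
  · exact fun _ _ => rfl
  · exact fun _ _ _ => rfl
  rintro ((k | k) | (k | k)) hk
  · rfl
  · exact absurd ⟨k, rfl⟩ hk
  all_goals rfl

variable (M₁ M₂ G) [Fintype Γ] [DecidableEq Γ]

/-- The program that turns the input `t # t'' # y` into the word `t'` computed by `G` from `t` and
`t''`, and keeps `t`, `t''` and `y`. -/
noncomputable def selectPhase :
    Module (StackAlphabet M₁.tm.Γ M₂.tm.Γ Γ) (Store M₁.tm.σ M₂.tm.σ Γ) :=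
  (transfer (readReg .inp) (writeReg .r₁) id).seq <|
  (transfer (readReg .inp) (writeReg .r₂)
    fun q => pushMain (pushMain q fun _ => .bit1) fun _ => .cons).seq <|
  (transfer (readReg .r₂) (fun q => writeCode (writeReg .r₃ q))
    fun q => pushMain q fun _ => .bit1).seq <|
  (transfer (readReg .r₁) (fun q => writeCode (writeReg .r₂ q)) id).seq <|
  embedMain M₁ M₂ G

/-- The program that runs `M₁` on `t # t' # y` and keeps `t'`. -/
noncomputable def firstPhase :
    Module (StackAlphabet M₁.tm.Γ M₂.tm.Γ Γ) (Store M₁.tm.σ M₂.tm.σ Γ) :=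
  (transfer (readReg .inp) (writeReg .tmp) id).seq <|
  (transfer (readReg .tmp) (fun q => push₁ q _ fun s => M₁.inputAlphabet.symm s.2.2.2)
    fun q => push₁ q _ fun _ => M₁.inputAlphabet.symm none).seq <|
  (transfer readCode (writeReg .tmp) id).seq <|
  (transfer (readReg .tmp)
    (fun q => push₁ (writeReg .r₁ q) _ fun s => M₁.inputAlphabet.symm s.2.2.2)
    fun q => push₁ q _ fun _ => M₁.inputAlphabet.symm none).seq <|
  (transfer (readReg .r₂) (writeReg .tmp) id).seq <|
  (transfer (readReg .tmp) (fun q => push₁ q _ fun s => M₁.inputAlphabet.symm s.2.2.2) id).seq <|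
  embed₁ M₁ M₂

/-- The program that runs `M₂` on `t' # t'' # z`, where `z` is the output of `M₁`. -/
def secondPhase : Module (StackAlphabet M₁.tm.Γ M₂.tm.Γ Γ) (Store M₁.tm.σ M₂.tm.σ Γ) :=
  (transfer (fun q => pop₁ q _ fun s o => setBuf s (o.map M₁.outputAlphabet))
    (writeReg .tmp) id).seq <|
  (transfer (readReg .tmp) (fun q => push₂ q _ fun s => M₂.inputAlphabet.symm s.2.2.2)
    fun q => push₂ q _ fun _ => M₂.inputAlphabet.symm none).seq <|
  (transfer (readReg .r₃) (writeReg .tmp) id).seq <|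
  (transfer (readReg .tmp) (fun q => push₂ q _ fun s => M₂.inputAlphabet.symm s.2.2.2)
    fun q => push₂ q _ fun _ => M₂.inputAlphabet.symm none).seq <|
  (transfer (readReg .r₁) (writeReg .tmp) id).seq <|
  (transfer (readReg .tmp) (fun q => push₂ q _ fun s => M₂.inputAlphabet.symm s.2.2.2) id).seq <|
  embed₂ M₁ M₂

/-- The program that, on input `t # t'' # y`, computes `t'` by `G` from `t` and `t''`, then runs
`M₁` on `t # t' # y` and, with the output `z`, `M₂` on `t' # t'' # z`. -/
noncomputable def compose :
    Module (StackAlphabet M₁.tm.Γ M₂.tm.Γ Γ) (Store M₁.tm.σ M₂.tm.σ Γ) :=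
  (selectPhase M₁ M₂ G).seq <| (firstPhase M₁ M₂).seq <| secondPhase M₁ M₂

variable {M₁ M₂ G} {t t' t'' y z w : List Γ}

theorem selectPhase_runs
    (hG : G.Runs none n (K'.elim (pairCode (t, t'') ++ [.bit1, .cons]) [] [] [])
      (K'.elim (wordCode t' ++ [.bit1, .cons]) [] [] [])) {S₁ S₂} :
    (selectPhase M₁ M₂ G).Runs (M₁.tm.initialState, M₂.tm.initialState, none, none)
      (n + 2 * (t.length + t''.length + 2))
      (stk S₁ S₂ (K'.elim [] [] [] []) (regs (encodeTriple (t, t'', y)) [] [] [] []))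
      (stk S₁ S₂ (K'.elim (wordCode t' ++ [.bit1, .cons]) [] [] [])
        (regs (y.map some) [] (t.map some) (t''.map some) [])) := by
  simp only [pairCode, List.append_assoc, List.cons_append] at hG
  -- The code is built from its end, so `t''` is encoded before `t`; both words are copied on the
  -- way.
  have h := (runs_readInput t).seq <| (runs_readInput₂ t'').seq <| (runs_encode_r₂ t'' _).seq <|
    (runs_encode_r₁ t _).seq <|
    embedMain_runs (M₁ := M₁) (M₂ := M₂) (R := regs (y.map some) _ _ _ []) (S₁ := S₁) (S₂ := S₂) hG
  exact h.of_eq (by omega)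

theorem firstPhase_runs
    (h₁ : (ofFinTM2 M₁.tm).Runs M₁.tm.initialState n₁
      (single M₁.tm.k₀ ((encodeTriple (t, t', y)).map M₁.inputAlphabet.symm))
      (single M₁.tm.k₁ (z.map M₁.outputAlphabet.symm))) {S₂} {c : List (Option Γ)} :
    (firstPhase M₁ M₂).Runs (M₁.tm.initialState, M₂.tm.initialState, none, none)
      (n₁ + 2 * (t.length + t'.length + y.length + 3))
      (stk (fun _ => []) S₂ (K'.elim (wordCode t' ++ [.bit1, .cons]) [] [] [])
        (regs (y.map some) [] (t.map some) c []))
      (stk (single M₁.tm.k₁ (z.map M₁.outputAlphabet.symm)) S₂ (K'.elim [] [] [] [])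
        (regs [] (t'.map some) [] c [])) := by
  simp only [encodeTriple, List.map_append, List.map_map, List.map_cons, Function.comp_def] at h₁
  -- The input stack is filled from the bottom: `y`, then `t'`, then `t`, each through `tmp` because
  -- a transfer reverses.
  have h := (runs_toTmp_inp y).seq <| (runs_tmpTo₁_sep _ M₁.inputAlphabet.symm y []).seq <|
    (runs_decode t').seq <| (runs_tmpTo₁_sep_r₁ _ M₁.inputAlphabet.symm t' _).seq <|
    (runs_toTmp_r₂ t).seq <| (runs_tmpTo₁ _ M₁.inputAlphabet.symm t _).seq <|
    embed₁_runs (M₂ := M₂) (S₂ := S₂) (R := regs [] _ _ c []) (by rwa [List.append_nil])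
  rw [single_nil] at h
  exact h.of_eq (by omega)

theorem secondPhase_runs
    (h₂ : (ofFinTM2 M₂.tm).Runs M₂.tm.initialState n₂
      (single M₂.tm.k₀ ((encodeTriple (t', t'', z)).map M₂.inputAlphabet.symm))
      (single M₂.tm.k₁ (w.map M₂.outputAlphabet.symm))) {P} :
    (secondPhase M₁ M₂).Runs (M₁.tm.initialState, M₂.tm.initialState, none, none)
      (n₂ + 2 * (t'.length + t''.length + z.length + 3))
      (stk (single M₁.tm.k₁ (z.map M₁.outputAlphabet.symm)) (fun _ => []) P
        (regs [] (t'.map some) [] (t''.map some) []))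
      (stk (fun _ => []) (single M₂.tm.k₁ (w.map M₂.outputAlphabet.symm)) P
        (regs [] [] [] [] [])) := by
  simp only [encodeTriple, List.map_append, List.map_map, List.map_cons, Function.comp_def] at h₂
  have h := (runs_toTmp₁ _ M₁.outputAlphabet z).seq <|
    (runs_tmpTo₂_sep _ M₂.inputAlphabet.symm z []).seq <|
    (runs_toTmp_r₃ t'').seq <| (runs_tmpTo₂_sep _ M₂.inputAlphabet.symm t'' _).seq <|
    (runs_toTmp_r₁ t').seq <| (runs_tmpTo₂ _ M₂.inputAlphabet.symm t' _).seq <|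
    embed₂_runs (M₁ := M₁) (P := P) (R := regs [] _ [] _ []) (by rwa [List.append_nil])
  rw [single_nil] at h
  exact h.of_eq (by omega)

theorem compose_runs
    (hG : G.Runs none n (K'.elim (pairCode (t, t'') ++ [.bit1, .cons]) [] [] [])
      (K'.elim (wordCode t' ++ [.bit1, .cons]) [] [] []))
    (h₁ : (ofFinTM2 M₁.tm).Runs M₁.tm.initialState n₁
      (single M₁.tm.k₀ ((encodeTriple (t, t', y)).map M₁.inputAlphabet.symm))
      (single M₁.tm.k₁ (z.map M₁.outputAlphabet.symm)))
    (h₂ : (ofFinTM2 M₂.tm).Runs M₂.tm.initialState n₂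
      (single M₂.tm.k₀ ((encodeTriple (t', t'', z)).map M₂.inputAlphabet.symm))
      (single M₂.tm.k₁ (w.map M₂.outputAlphabet.symm))) :
    ∃ N ≤ n + n₁ + n₂ + 4 * (t.length + t'.length + t''.length + y.length + z.length + 4),
      (compose M₁ M₂ G).Runs (M₁.tm.initialState, M₂.tm.initialState, none, none) N
        (stk (fun _ => []) (fun _ => []) (fun _ => [])
          (update (fun _ => []) .inp (encodeTriple (t, t'', y))))
        (stk (fun _ => []) (single M₂.tm.k₁ (w.map M₂.outputAlphabet.symm)) (fun _ => [])
          (fun _ => [])) := by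
  have hP : (fun _ : K' => ([] : List Γ')) = K'.elim [] [] [] [] := by
    funext k; cases k <;> rfl
  have hR : (fun _ : Register => ([] : List (Option Γ))) = regs [] [] [] [] [] := by
    funext k; cases k <;> rfl
  rw [hP, hR, update_regs_inp]
  exact ⟨_, by omega,
    (selectPhase_runs hG).seq <| (firstPhase_runs h₁).seq <| secondPhase_runs h₂⟩

end Compose

end Turing.SliceComposition

/-! ### The bundled machine and its output length. -/

namespace Turing.SliceComposition

open TM2 PartrecToTM2

section Output

variable {Γ : Type} [Fintype Γ] [DecidableEq Γ] (M₁ M₂ : TM2ComputableAux (Option Γ) Γ)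
  (G : Module (fun _ : K' => Γ') (Option Γ'))

/-- The bundled machine that runs the composed program. -/
noncomputable def composeMachine : TM2ComputableAux (Option Γ) Γ :=
  haveI : Fintype K' := ⟨{.main, .rev, .aux, .stack}, by rintro (_ | _ | _ | _) <;> decide⟩
  haveI := M₁.tm.kFin
  haveI := M₂.tm.kFin
  haveI := M₁.tm.σFin
  haveI := M₂.tm.σFin
  haveI := (compose M₁ M₂ G).fintype
  { tm :=
      { K := StackIndex M₁.tm.K M₂.tm.K
        k₀ := .inr (.inr .inp)
        k₁ := .inl (.inr M₂.tm.k₁)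
        Γ := StackAlphabet M₁.tm.Γ M₂.tm.Γ Γ
        Λ := (compose M₁ M₂ G).Λ
        main := (compose M₁ M₂ G).main
        σ := Store M₁.tm.σ M₂.tm.σ Γ
        initialState := (M₁.tm.initialState, M₂.tm.initialState, none, none)
        Γk₀Fin := inferInstanceAs (Fintype (Option Γ))
        m := (compose M₁ M₂ G).m }
    inputAlphabet := Equiv.refl _
    outputAlphabet := M₂.outputAlphabet }

variable {M₁ M₂ G}

theorem composeMachine_outputs {t t' t'' y z w : List Γ} {n n₁ n₂ : ℕ}
    (hG : G.Runs none n (K'.elim (pairCode (t, t'') ++ [.bit1, .cons]) [] [] [])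
      (K'.elim (wordCode t' ++ [.bit1, .cons]) [] [] []))
    (h₁ : (ofFinTM2 M₁.tm).Runs M₁.tm.initialState n₁
      (single M₁.tm.k₀ ((encodeTriple (t, t', y)).map M₁.inputAlphabet.symm))
      (single M₁.tm.k₁ (z.map M₁.outputAlphabet.symm)))
    (h₂ : (ofFinTM2 M₂.tm).Runs M₂.tm.initialState n₂
      (single M₂.tm.k₀ ((encodeTriple (t', t'', z)).map M₂.inputAlphabet.symm))
      (single M₂.tm.k₁ (w.map M₂.outputAlphabet.symm))) {B : ℕ}
    (hB : n + n₁ + n₂ + 4 * (t.length + t'.length + t''.length + y.length + z.length + 4) ≤ B) :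
    Nonempty (TM2OutputsInTime (composeMachine M₁ M₂ G).tm
      ((encodeTriple (t, t'', y)).map (composeMachine M₁ M₂ G).inputAlphabet.symm)
      (some (w.map (composeMachine M₁ M₂ G).outputAlphabet.symm)) B) := by
  obtain ⟨N, hN, h⟩ := compose_runs hG h₁ h₂
  refine outputsInTime_iff.2 ⟨N, hN.trans hB, ?_⟩
  have h0 : stk (fun _ => []) (fun _ => []) (fun _ => []) (fun _ => []) =
      fun k : StackIndex M₁.tm.K M₂.tm.K =>
        ([] : List (StackAlphabet M₁.tm.Γ M₂.tm.Γ Γ k)) := by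
    funext k
    obtain (k | k) | (k | k) := k <;> rfl
  rw [← update_stk_reg, single, ← update_stk₂, h0] at h
  have hmap : (encodeTriple (t, t'', y)).map (composeMachine M₁ M₂ G).inputAlphabet.symm =
    encodeTriple (t, t'', y) := List.map_id _
  rw [hmap]
  exact h

end Output

section Length

theorem length_single_le {K : Type} [DecidableEq K] {Γ : K → Type} (k k' : K) (L : List (Γ k)) :
    (single k L k').length ≤ L.length := by
  by_cases h : k' = k
  · subst h; simp
  · simp [single, h]

/-- The length of the output of a machine is linear in the length of the input and the running
time. -/
theorem exists_length_output_le {A Γ : Type} (M : TM2ComputableAux A Γ) :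
    ∃ c : ℕ, ∀ (n : ℕ) (u : List A) (z : List Γ),
      (ofFinTM2 M.tm).Runs M.tm.initialState n (single M.tm.k₀ (u.map M.inputAlphabet.symm))
        (single M.tm.k₁ (z.map M.outputAlphabet.symm)) → z.length ≤ u.length + c * n := by
  have := M.tm.ΛFin
  -- The sum over the finitely many labels dominates the pushes of any single statement.
  refine ⟨∑ l, (M.tm.m l).pushes, fun n u z h => ?_⟩
  have h₁ := Steps.length_le (c := ∑ l, (M.tm.m l).pushes)
    (fun l => Finset.single_le_sum (f := fun l => (M.tm.m l).pushes) (fun _ _ => Nat.zero_le _)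
      (Finset.mem_univ l)) h M.tm.k₁
  have h₂ := length_single_le M.tm.k₀ M.tm.k₁ (u.map M.inputAlphabet.symm)
  simp only [single_self, List.length_map] at h₁ h₂
  omega

end Length

end Turing.SliceComposition

/-! ### Arithmetic of the time bound. -/

section Bounds

theorem Polynomial.eval_nat_mono (p : Polynomial ℕ) {a b : ℕ} (h : a ≤ b) :
    p.eval a ≤ p.eval b := by
  simp only [Polynomial.eval_eq_sum_range]
  exact Finset.sum_le_sum fun i _ => Nat.mul_le_mul_left _ (Nat.pow_le_pow_left h i)

/-- Splits a parameter-dependent factor off the argument of a polynomial; `1 ≤ a` gives `a ^ i ≤ a ^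
p.natDegree`. -/
theorem Polynomial.eval_nat_mul_le (p : Polynomial ℕ) {a : ℕ} (ha : 1 ≤ a) (b : ℕ) :
    p.eval (a * b) ≤ a ^ p.natDegree * p.eval b := by
  simp only [Polynomial.eval_eq_sum_range, Finset.mul_sum]
  refine Finset.sum_le_sum fun i hi => ?_
  rw [mul_pow, mul_left_comm]
  exact Nat.mul_le_mul_right _ (Nat.pow_le_pow_right ha (by simpa [Nat.lt_succ_iff] using hi))

theorem Primrec.pow_const {α : Type} [Primcodable α] {f : α → ℕ} (hf : Primrec f) (d : ℕ) :
    Primrec fun a => f a ^ d := by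
  induction d with
  | zero => simpa using Primrec.const 1
  | succ d ih => simpa only [pow_succ] using Primrec.nat_mul.comp ih hf

/-- The parameter part of the running time of the composition of two machines. -/
def compositionFactor (c d₁ d₂ l n N₁ N₂ : ℕ) : ℕ :=
  n + N₁ * (1 + l) ^ d₁ +
    N₂ * (2 * (1 + l) + c * (N₁ * (1 + l) ^ d₁)) ^ d₂ +
    8 * (2 * (1 + l) + c * (N₁ * (1 + l) ^ d₁))

/-- The polynomial part of the running time of the composition of two machines. -/
noncomputable def compositionPoly (p₁ p₂ : Polynomial ℕ) : Polynomial ℕ :=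
  1 + p₁ + p₂.comp (Polynomial.X + p₁) + (Polynomial.X + p₁)

/-- The length `l` of `t'` is not bounded by the input length, so it is moved into the factor. Both
machine inputs are at most a parameter factor times a polynomial in `L`: `(1 + l) * L` for the
first, `B * q` for the second. -/
theorem composition_bound (p₁ p₂ : Polynomial ℕ) {c a l b y z n N₁ N₂ n₁ n₂ : ℕ}
    (h₁ : n₁ ≤ N₁ * p₁.eval (a + l + y + 2)) (hz : z ≤ a + l + y + 2 + c * n₁)
    (h₂ : n₂ ≤ N₂ * p₂.eval (l + b + z + 2)) :
    n + n₁ + n₂ + 4 * (a + l + b + y + z + 4) ≤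
      compositionFactor c p₁.natDegree p₂.natDegree l n N₁ N₂ *
        (compositionPoly p₁ p₂).eval (a + b + y + 2) := by
  set L := a + b + y + 2 with hL
  set A := N₁ * (1 + l) ^ p₁.natDegree with hA
  set B := 2 * (1 + l) + c * A with hB
  set q := L + p₁.eval L with hq
  have hl : l ≤ l * L := Nat.le_mul_of_pos_right _ (by omega)
  have hin₁ : a + l + y + 2 ≤ (1 + l) * L := by rw [add_mul, one_mul]; omega
  have hn₁ : n₁ ≤ A * p₁.eval L := by
    refine h₁.trans ?_
    rw [hA, mul_assoc]
    exact Nat.mul_le_mul_left _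
      ((p₁.eval_nat_mono hin₁).trans (p₁.eval_nat_mul_le (by omega) _))
  have hBq : 2 * ((1 + l) * L) + c * (A * p₁.eval L) ≤ B * q := by
    -- The right side exceeds the left by `2 * (1 + l) * p₁.eval L + c * A * L`.
    rw [hB, hq]
    nlinarith [Nat.zero_le (c * A * L), Nat.zero_le ((1 + l) * p₁.eval L)]
  have hcn : c * n₁ ≤ c * (A * p₁.eval L) := Nat.mul_le_mul_left _ hn₁
  have hin₂ : l + b + z + 2 ≤ B * q := by
    refine le_trans ?_ hBq
    have : (1 + l) * L = L + l * L := by ring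
    omega
  have hn₂ : n₂ ≤ N₂ * B ^ p₂.natDegree * p₂.eval q := by
    refine h₂.trans ?_
    rw [mul_assoc]
    exact Nat.mul_le_mul_left _
      ((p₂.eval_nat_mono hin₂).trans (p₂.eval_nat_mul_le (by omega) _))
  have hsum : 4 * (a + l + b + y + z + 4) ≤ 8 * B * q := by
    have : 8 * B * q = 8 * (B * q) := by ring
    have : (1 + l) * L ≤ B * q := by omega
    omega
  have hF : compositionFactor c p₁.natDegree p₂.natDegree l n N₁ N₂ =
      n + A + N₂ * B ^ p₂.natDegree + 8 * B := rfl
  have hP : (compositionPoly p₁ p₂).eval L = 1 + p₁.eval L + p₂.eval q + q := by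
    simp [compositionPoly, hq]
  rw [hF, hP]
  generalize N₂ * B ^ p₂.natDegree = C at *
  calc n + n₁ + n₂ + 4 * (a + l + b + y + z + 4)
      ≤ n * 1 + A * p₁.eval L + C * p₂.eval q + 8 * B * q := by omega
    _ ≤ _ := by
      generalize 8 * B = D
      generalize p₁.eval L = x₁
      generalize p₂.eval q = x₂
      have : (n + A + C + D) * (1 + x₁ + x₂ + q) = n * 1 + A * x₁ + C * x₂ + D * q +
        (n * (x₁ + x₂ + q) + A * (1 + x₂ + q) + C * (1 + x₁ + q) + D * (1 + x₁ + x₂)) := by ring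
      rw [this]
      exact Nat.le_add_right _ _

theorem primrec_compositionFactor {α : Type} [Primcodable α] (c d₁ d₂ : ℕ) {l n N₁ N₂ : α → ℕ}
    (hl : Primrec l) (hn : Primrec n) (h₁ : Primrec N₁) (h₂ : Primrec N₂) :
    Primrec fun a => compositionFactor c d₁ d₂ (l a) (n a) (N₁ a) (N₂ a) := by
  have hl' : Primrec fun a => 1 + l a := Primrec.nat_add.comp (Primrec.const 1) hl
  have hA : Primrec fun a => N₁ a * (1 + l a) ^ d₁ := Primrec.nat_mul.comp h₁ (hl'.pow_const d₁)
  have hB : Primrec fun a => 2 * (1 + l a) + c * (N₁ a * (1 + l a) ^ d₁) :=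
    Primrec.nat_add.comp (Primrec.nat_mul.comp (Primrec.const 2) hl')
      (Primrec.nat_mul.comp (Primrec.const c) hA)
  exact Primrec.nat_add.comp (Primrec.nat_add.comp (Primrec.nat_add.comp hn hA)
    (Primrec.nat_mul.comp h₂ (hB.pow_const d₂))) (Primrec.nat_mul.comp (Primrec.const 8) hB)

end Bounds

/-! ### Assembling the reduction. -/

theorem length_encodeTriple {Γ : Type} (t t' y : List Γ) :
    (encodeTriple (t, t', y)).length = t.length + t'.length + y.length + 2 := by
  simp [encodeTriple]; omega

open Turing Turing.SliceComposition in
theorem FPTComputable.comp_selector {Γ : Type} [Fintype Γ] [Primcodable Γ]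
    {g : List Γ × List Γ →. List Γ} (hg : Partrec g)
    {r₁ r₂ : List Γ × List Γ × List Γ →. List Γ}
    (h₁ : FPTComputable encodeTriple (fun x : List Γ × List Γ × List Γ => (x.1, x.2.1)) r₁)
    (h₂ : FPTComputable encodeTriple (fun x : List Γ × List Γ × List Γ => (x.1, x.2.1)) r₂) :
    FPTComputable encodeTriple (fun x : List Γ × List Γ × List Γ => (x.1, x.2.1))
      fun x => (g (x.1, x.2.1)).bind fun t' =>
        (r₁ (x.1, t', x.2.2)).bind fun z => r₂ (t', x.2.1, z) := by
  classical
  obtain ⟨f₁, p₁, M₁, hf₁, hM₁⟩ := h₁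
  obtain ⟨f₂, p₂, M₂, hf₂, hM₂⟩ := h₂
  obtain ⟨G, T, hT, hG⟩ := PartrecToTM2.exists_module_of_partrec_words hg
  obtain ⟨c, hc⟩ := exists_length_output_le M₁
  -- Every ingredient of the factor is determined by `(t, t'')`, and partial computability suffices
  -- since all are defined on the domain.
  refine ⟨fun p => (g p).bind fun t' => (T p).bind fun n => (f₁ (p.1, t')).bind fun N₁ =>
    (f₂ (t', p.2)).map fun N₂ =>
      compositionFactor c p₁.natDegree p₂.natDegree t'.length n N₁ N₂,
    compositionPoly p₁ p₂, composeMachine M₁ M₂ G, ?_, ?_⟩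
  · refine hg.bind (Partrec.bind (hT.comp Computable.fst) (Partrec.bind (hf₁.comp ?_)
      (Partrec.map (hf₂.comp ?_) ?_)))
    · exact (Primrec.pair (Primrec.fst.comp (Primrec.fst.comp Primrec.fst))
        (Primrec.snd.comp Primrec.fst)).to_comp
    · exact (Primrec.pair (Primrec.snd.comp (Primrec.fst.comp Primrec.fst))
        (Primrec.snd.comp (Primrec.fst.comp (Primrec.fst.comp Primrec.fst)))).to_comp
    · refine (primrec_compositionFactor c p₁.natDegree p₂.natDegree
        (Primrec.list_length.comp (Primrec.snd.comp
          (Primrec.fst.comp (Primrec.fst.comp Primrec.fst))))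
        (Primrec.snd.comp (Primrec.fst.comp Primrec.fst))
        (Primrec.snd.comp Primrec.fst) Primrec.snd).to_comp
  · rintro ⟨t, t'', y⟩ w hw
    obtain ⟨t', ht', hw⟩ := Part.mem_bind_iff.1 hw
    obtain ⟨z, hz, hw⟩ := Part.mem_bind_iff.1 hw
    obtain ⟨n, hn, hGn⟩ := hG _ _ ht'
    obtain ⟨N₁, hN₁, hout₁⟩ := hM₁ _ _ hz
    obtain ⟨N₂, hN₂, hout₂⟩ := hM₂ _ _ hw
    obtain ⟨n₁, hn₁, hrun₁⟩ := outputsInTime_iff.1 hout₁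
    obtain ⟨n₂, hn₂, hrun₂⟩ := outputsInTime_iff.1 hout₂
    have hlen := hc _ _ _ hrun₁
    rw [length_encodeTriple] at hn₁ hn₂ hlen
    refine ⟨_, Part.mem_bind ht' (Part.mem_bind hn (Part.mem_bind hN₁ (Part.mem_map _ hN₂))),
      composeMachine_outputs hGn hrun₁ hrun₂ ?_⟩
    rw [length_encodeTriple]
    exact composition_bound p₁ p₂ hn₁ hlen hn₂

theorem mainTheorem10 {Γ : Type} [Fintype Γ] [Primcodable Γ] (C₁ C₂ C₃ : CaseProblem Γ)
    (h₁₂ : C₁.SliceReducesTo C₂) (h₂₃ : C₂.SliceReducesTo C₃) :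
    C₁.SliceReducesTo C₃ := by
  obtain ⟨U₁, r₁, h₁⟩ := h₁₂
  obtain ⟨U₂, r₂, h₂⟩ := h₂₃
  have hW : REPred fun q : (List Γ × List Γ) × List Γ =>
      (q.1.1, q.2) ∈ U₁ ∧ (q.2, q.1.2) ∈ U₂ :=
    (h₁.re.comp (Primrec.pair (Primrec.fst.comp Primrec.fst) Primrec.snd).to_comp).and
      (h₂.re.comp (Primrec.pair Primrec.snd (Primrec.snd.comp Primrec.fst)).to_comp)
  obtain ⟨g, hg, hdom, hspec⟩ := hW.exists_selector
  -- The mapping is left to unification with `FPTComputable.comp_selector`.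
  refine ⟨{u | (g u).Dom}, _, hg.dom_re, fun t t'' y => ?_,
    FPTComputable.comp_selector hg h₁.fpt h₂.fpt, fun s hs => ?_, ?_⟩
  · constructor
    · intro h
      exact h.1
    · intro h
      obtain ⟨t', ht'⟩ := Part.dom_iff_mem.1 h
      obtain ⟨hU₁, hU₂⟩ := hspec _ _ ht'
      obtain ⟨z, hz⟩ := Part.dom_iff_mem.1 ((h₁.dom t t' y).2 hU₁)
      -- The domain of `r₂` does not restrict its third argument, so any output `z` of `r₁` is
      -- admissible.
      obtain ⟨w, hw⟩ := Part.dom_iff_mem.1 ((h₂.dom t' t'' z).2 hU₂)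
      exact Part.dom_iff_mem.2 ⟨w, Part.mem_bind ht' (Part.mem_bind hz hw)⟩
  · obtain ⟨s', hs', hU₁⟩ := h₁.coverage s hs
    obtain ⟨s'', hs'', hU₂⟩ := h₂.coverage s' hs'
    exact ⟨s'', hs'', (hdom _).2 ⟨s', hU₁, hU₂⟩⟩
  · intro t t'' _ y w hw
    obtain ⟨t', ht', hw⟩ := Part.mem_bind_iff.1 hw
    obtain ⟨z, hz, hw⟩ := Part.mem_bind_iff.1 hw
    obtain ⟨hU₁, hU₂⟩ := hspec _ _ ht'
    exact (h₁.correctness t t' hU₁ y z hz).trans (h₂.correctness t' t'' hU₂ z w hw)
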